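/- **Notation.** A composition is a sequence ${\bf k}=(k_1,\ldots,k_r)$ of positive integers with $r\ge 1$; put $|{\bf k}|=k_1+\cdots+k_r$, $\mathrm{dep}({\bf k})=r$, $\overleftarrow{\bf k}=(k_r,\ldots,k_1)$ and ${\bf k}_+=(k_1+1,k_2,\ldots,k_r)$. The Hoffman dual ${\bf k}^\vee=(k_1',\ldots,k_{r'}')$ is the composition with $|{\bf k}^\vee|=|{\bf k}|$ for which $\{1,\ldots,|{\bf k}|-1\}$ is the disjoint union of $\{k_1+\cdots+k_j: 1\le j<r\}$ and $\{k_1'+\cdots+k_j': 1\le j<r'\}$. For ${\bf j}=(j_1,\ldots,j_r)\in\mathbb{Z}_{\ge 0}^r$ let $B({\bf k};{\bf j})=\prod_{i=1}^r\binom{k_i+j_i-1}{j_i}$; write $|{\bf j}|=j_1+\cdots+j_r$ and $\mathrm{dep}({\bf j})=r$. Let $$\zeta_n({\bf k};\alpha)=\sum_{n\ge n_1>\cdots>n_r>0}\prod_{i=1}^r\frac{1}{(n_i+\alpha-1)^{k_i}},\qquad \zeta_n({\bf k})=\zeta_n({\bf k};1),\qquad \zeta^\star_n({\bf k})=\sum_{n\ge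 n_1\ge\cdots\ge n_r>0}\prod_{i=1}^r\frac1{n_i^{k_i}},$$ all equal to $1$ for the empty index, and for $k_1\ge 2$ let $\zeta({\bf k};\alpha)=\lim_{n\to\infty}\zeta_n({\bf k};\alpha)$ and $\zeta({\bf k})=\zeta({\bf k};1)$, with $\zeta(\emptyset)=1$. Here $\{1\}_k$ is the sequence of $k$ ones, and $\binom{a}{b}=\frac{\Gamma(a+1)}{\Gamma(b+1)\Gamma(a-b+1)}$. **Theorem.** Let ${\bf k}=(k_1,\ldots,k_r)$ be a composition, put $k_{r+1}:=2$, let $k\ge 0$ be an integer and let $\alpha\in\mathbb{C}\setminus\mathbb{Z}$ with $\Re(\alpha)<1$. Then all the limits and series below converge (the series over $n$ absolutely), and $$\begin{aligned} &\delta_{0,k}\,\zeta(k_1+1,k_2,\ldots,k_r)+\sum_{j=1}^{k_1-1}(-1)^{j-1}\zeta(k_1+1-j,k_2,\ldots,k_r)\sum_{n=1}^\infty\frac{\binom{n+\alpha-1}{n}\zeta_n(\{1\}_k;\alpha)}{n^j}\\ &+\sum_{l=1}^{r}(-1)^{k_1+\cdots+k_l-l}\sum_{j=1}^{k_{l+1}-1}(-1)^{j-1}\zeta(k_{l+1}+1-j,k_{l+2},\ldots,k_r)\sum_{n=1}^\infty\frac{\binom{n+\alpha-1}{n}\zeta_n(\{1\}_k;\alpha)\,\zeta_n^\star(k_2,\ldots,k_l,j)}{n^{k_1}}\\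 &=\sum_{\substack{|{\bf j}|=k\\ \mathrm{dep}({\bf j})=|{\bf k}|+1-\mathrm{dep}({\bf k})}}B\big((\overleftarrow{\bf k}^\vee)_+;{\bf j}\big)\,\zeta\big((\overleftarrow{\bf k}^\vee)_++{\bf j};1-\alpha\big), \end{aligned}$$ where for $l=r$ the index $(k_{r+1}+1-j,k_{r+2},\ldots,k_r)$ is read as $\emptyset$, $(k_2,\ldots,k_l,j)$ is $(j)$ for $l=1$, and $\delta_{0,k}$ is $1$ for $k=0$ and $0$ otherwise. -/

import Mathlib

open Filter Topology

noncomputable section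

namespace Apery

/-! Compositions `(k₁, …, k_r)` are lists of positive integers; `[]` is the empty index. -/

/-- `k` is a nonempty finite sequence of positive integers. -/
def IsComposition (k : List ℕ) : Prop := k ≠ [] ∧ ∀ m ∈ k, 0 < m

/-- All entries are positive and the first one, if there is one, is at least `2`. -/
def IsAdmissible (s : List ℕ) : Prop := (∀ m ∈ s, 0 < m) ∧ ∀ m ∈ s.head?, 2 ≤ m

/-- The part `k_i` (counted from `1`) of `k = (k₁, …, k_r)`, with the convention `k_{r+1} := 2`. -/
def part (k : List ℕ) (i : ℕ) : ℕ := (k ++ [2]).getD (i - 1) 0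

/-- The segment `(k_i, …, k_j)`, counted from `1`; it is empty if `i > j`. -/
def seg (k : List ℕ) (i j : ℕ) : List ℕ := (k.take j).drop (i - 1)

/-- `k₊ = (k₁ + 1, k₂, …, k_r)`. -/
def addHead : List ℕ → List ℕ
  | [] => []
  | m :: t => (m + 1) :: t

/-- The Hoffman dual `k^∨`, obtained by exchanging commas and plus signs in
`k = (1 + ⋯ + 1, …, 1 + ⋯ + 1)`: the first part `k₁` contributes `k₁ - 1` ones that are now
followed by commas, and its last `1` is added to the first part of the dual of `(k₂, …, k_r)`. -/
def hoffmanDual : List ℕ → List ℕ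
  | [] => []
  | [m] => List.replicate m 1
  | m :: m' :: t => List.replicate (m - 1) 1 ++ addHead (hoffmanDual (m' :: t))

/-- The set of proper partial sums `k₁ + ⋯ + k_j`, `1 ≤ j ≤ r - 1`. -/
def partialSums (k : List ℕ) : Finset ℕ :=
  (Finset.Ico 1 k.length).image fun j => (k.take j).sum

/-- `B(k; j) = ∏ᵢ binom(kᵢ + jᵢ - 1, jᵢ)`. -/
def binomProd (k j : List ℕ) : ℕ := (List.zipWith (fun a b => (a + b - 1).choose b) k j).prod

/-- The multiple harmonic sum
`ζ_n(k₁, …, k_r) = ∑_{n ≥ n₁ > ⋯ > n_r > 0} 1 / (n₁^{k₁} ⋯ n_r^{k_r})`,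
summed over the largest variable `n₁ = m` first. -/
def mhs (n : ℕ) : List ℕ → ℂ
  | [] => 1
  | a :: t => ∑ m ∈ Finset.Icc 1 n, 1 / (m : ℂ) ^ a * mhs (m - 1) t

/-- The multiple harmonic star sum
`ζ⋆_n(k₁, …, k_r) = ∑_{n ≥ n₁ ≥ ⋯ ≥ n_r > 0} 1 / (n₁^{k₁} ⋯ n_r^{k_r})`. -/
def mhsStar (n : ℕ) : List ℕ → ℂ
  | [] => 1
  | a :: t => ∑ m ∈ Finset.Icc 1 n, 1 / (m : ℂ) ^ a * mhsStar m t

/-- The Hurwitz-type multiple harmonic sum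
`ζ_n(k; α) = ∑_{n ≥ n₁ > ⋯ > n_r > 0} 1 / ((n₁ + α - 1)^{k₁} ⋯ (n_r + α - 1)^{k_r})`. -/
def hurwitzMhs (α : ℂ) (n : ℕ) : List ℕ → ℂ
  | [] => 1
  | a :: t => ∑ m ∈ Finset.Icc 1 n, 1 / ((m : ℂ) + α - 1) ^ a * hurwitzMhs α (m - 1) t

/-- The multiple zeta value `ζ(k) = lim_{n → ∞} ζ_n(k)`. -/
def mzv (k : List ℕ) : ℂ := limUnder atTop fun n => mhs n k

/-- The Hurwitz-type multiple zeta value `ζ(k; α) = lim_{n → ∞} ζ_n(k; α)`. -/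
def hurwitzMzv (α : ℂ) (k : List ℕ) : ℂ := limUnder atTop fun n => hurwitzMhs α n k

/-- The binomial coefficient `Γ(a + 1) / (Γ(b + 1) Γ(a - b + 1))`. -/
def gammaBinom (a b : ℂ) : ℂ :=
  Complex.Gamma (a + 1) / (Complex.Gamma (b + 1) * Complex.Gamma (a - b + 1))

/-- The term `binom(n + α - 1, n) ζ_n({1}_q; α) ζ⋆_n(s) / n^e` of the Apéry-type series. -/
def aperyTerm (α : ℂ) (q : ℕ) (s : List ℕ) (e n : ℕ) : ℂ :=
  gammaBinom (n + α - 1) n * hurwitzMhs α n (List.replicate q 1) * mhsStar n s / (n : ℂ) ^ e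

/-- The Apéry-type series `∑_{n ≥ 1} binom(n + α - 1, n) ζ_n({1}_q; α) ζ⋆_n(s) / n^e`. -/
def aperySeries (α : ℂ) (q : ℕ) (s : List ℕ) (e : ℕ) : ℂ :=
  ∑' n : ℕ, aperyTerm α q s e (n + 1)

/-- The index `(k_{l+1} + 1 - j, k_{l+2}, …, k_r)`, which is `∅` for `l = r`. -/
def tailIndex (k : List ℕ) (l j : ℕ) : List ℕ :=
  if l = k.length then [] else (part k (l + 1) + 1 - j) :: seg k (l + 2) k.length

theorem partialSums_singleton (a : ℕ) : partialSums [a] = ∅ := by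
  simp [partialSums]

theorem mem_partialSums_cons {a : ℕ} {t : List ℕ} (ht : t ≠ []) (x : ℕ) :
    x ∈ partialSums (a :: t) ↔ x = a ∨ ∃ y ∈ partialSums t, x = a + y := by
  have hl : 0 < t.length := List.length_pos_iff.2 ht
  simp only [partialSums, Finset.mem_image, Finset.mem_Ico, List.length_cons]
  constructor
  · rintro ⟨j, ⟨h1, h2⟩, rfl⟩
    obtain ⟨i, rfl⟩ : ∃ i, j = i + 1 := ⟨j - 1, by omega⟩
    rcases Nat.eq_zero_or_pos i with rfl | hi
    · left; simp
    · right
      exact ⟨_, ⟨i, ⟨hi, by omega⟩, rfl⟩, by simp⟩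
  · rintro (rfl | ⟨y, ⟨j, ⟨h1, h2⟩, rfl⟩, rfl⟩)
    · exact ⟨1, ⟨le_rfl, by omega⟩, by simp⟩
    · exact ⟨j + 1, ⟨by omega, by omega⟩, by simp⟩

theorem mem_partialSums_addHead (d : List ℕ) (x : ℕ) :
    x ∈ partialSums (addHead d) ↔ ∃ y ∈ partialSums d, x = 1 + y := by
  cases d with
  | nil => simp [addHead, partialSums]
  | cons b t =>
    by_cases ht : t = []
    · subst ht; simp [addHead, partialSums_singleton]
    · simp only [addHead, mem_partialSums_cons ht]
      constructor
      · rintro (rfl | ⟨y, hy, rfl⟩)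
        · exact ⟨b, Or.inl rfl, by omega⟩
        · exact ⟨b + y, Or.inr ⟨y, hy, rfl⟩, by omega⟩
      · rintro ⟨y, (rfl | ⟨z, hz, rfl⟩), rfl⟩
        · left; omega
        · exact Or.inr ⟨z, hz, by omega⟩

theorem mem_partialSums_ones {d : List ℕ} (hd : d ≠ []) (p x : ℕ) :
    x ∈ partialSums (List.replicate p 1 ++ d) ↔
      (1 ≤ x ∧ x ≤ p) ∨ ∃ y ∈ partialSums d, x = p + y := by
  induction p generalizing x with
  | zero => simp; omega
  | succ p ih =>
    rw [List.replicate_succ, List.cons_append, mem_partialSums_cons (by simp [hd])]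
    simp only [ih]
    constructor
    · rintro (rfl | ⟨y, (h | ⟨z, hz, rfl⟩), rfl⟩)
      · left; omega
      · left; omega
      · exact Or.inr ⟨z, hz, by omega⟩
    · rintro (h | ⟨z, hz, rfl⟩)
      · by_cases hx : x = 1
        · exact Or.inl hx
        · exact Or.inr ⟨x - 1, Or.inl (by omega), by omega⟩
      · exact Or.inr ⟨p + z, Or.inr ⟨z, hz, rfl⟩, by omega⟩

/-- The Hoffman dual of a composition `k` is a composition of the same weight, and its proper
partial sums are the elements of `{1, …, |k| - 1}` that are not proper partial sums of `k`. -/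
theorem hoffmanDual_spec (k : List ℕ) (hk : IsComposition k) :
    IsComposition (hoffmanDual k) ∧ (hoffmanDual k).sum = k.sum ∧
      Disjoint (partialSums k) (partialSums (hoffmanDual k)) ∧
      partialSums k ∪ partialSums (hoffmanDual k) = Finset.Icc 1 (k.sum - 1) := by
  have key : IsComposition (hoffmanDual k) ∧ (hoffmanDual k).sum = k.sum ∧
      (∀ x, ¬ (x ∈ partialSums k ∧ x ∈ partialSums (hoffmanDual k))) ∧
      ∀ x, (x ∈ partialSums k ∨ x ∈ partialSums (hoffmanDual k)) ↔ 1 ≤ x ∧ x + 1 ≤ k.sum := by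
    induction k with
    | nil => exact absurd rfl hk.1
    | cons m t ih =>
      have hm : 0 < m := hk.2 m (by simp)
      cases t with
      | nil =>
        obtain ⟨p, rfl⟩ : ∃ p, m = p + 1 := ⟨m - 1, by omega⟩
        have e : hoffmanDual [p + 1] = List.replicate p 1 ++ [1] := by
          simp [hoffmanDual, List.replicate_succ']
        refine ⟨⟨by simp [e], by simp [e]; omega⟩, by simp [e], ?_, ?_⟩
        · simp [partialSums_singleton]
        · intro x
          rw [e, mem_partialSums_ones (by simp)]
          simp [partialSums_singleton]
      | cons m' t =>
        obtain ⟨⟨h1, h2⟩, h3, h4, h5⟩ :=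
          ih ⟨by simp, fun x hx => hk.2 x (List.mem_cons_of_mem _ hx)⟩
        obtain ⟨p, rfl⟩ : ∃ p, m = p + 1 := ⟨m - 1, by omega⟩
        have e : hoffmanDual ((p + 1) :: m' :: t)
            = List.replicate p 1 ++ addHead (hoffmanDual (m' :: t)) := by
          simp [hoffmanDual]
        set d := hoffmanDual (m' :: t) with hd
        have hne : addHead d ≠ [] := by
          cases hdd : d with
          | nil => exact absurd hdd h1
          | cons b s => simp [addHead]
        have hpos : ∀ y ∈ addHead d, 0 < y := by
          cases hdd : d with
          | nil => exact absurd hdd h1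
          | cons b s =>
            intro y hy
            simp only [addHead, List.mem_cons] at hy
            rcases hy with rfl | hy
            · omega
            · exact h2 y (by simp [hdd, hy])
        have hsum : (addHead d).sum = d.sum + 1 := by
          cases hdd : d with
          | nil => exact absurd hdd h1
          | cons b s => simp [addHead]; omega
        have hT : ∀ x, x ∈ partialSums ((p + 1) :: m' :: t) ↔
            x = p + 1 ∨ ∃ y ∈ partialSums (m' :: t), x = p + 1 + y :=
          fun x => mem_partialSums_cons (by simp) x
        have hD : ∀ x, x ∈ partialSums (List.replicate p 1 ++ addHead d) ↔
            (1 ≤ x ∧ x ≤ p) ∨ ∃ y ∈ partialSums d, x = p + 1 + y := by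
          intro x
          rw [mem_partialSums_ones hne]
          simp only [mem_partialSums_addHead]
          constructor
          · rintro (h | ⟨y, ⟨z, hz, rfl⟩, rfl⟩)
            · exact Or.inl h
            · exact Or.inr ⟨z, hz, by omega⟩
          · rintro (h | ⟨z, hz, rfl⟩)
            · exact Or.inl h
            · exact Or.inr ⟨1 + z, ⟨z, hz, rfl⟩, by omega⟩
        rw [e]
        refine ⟨⟨by simp [hne], ?_⟩, ?_, ?_, ?_⟩
        · intro y hy
          rcases List.mem_append.1 hy with hy | hy
          · rw [List.eq_of_mem_replicate hy]; omega
          · exact hpos y hy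
        · rw [List.sum_append, hsum, h3]; simp; omega
        · rintro x ⟨ha, hb⟩
          rw [hT] at ha
          rw [hD] at hb
          rcases ha with rfl | ⟨y, hy, rfl⟩ <;> rcases hb with hb | ⟨z, hz, hzz⟩
          · omega
          · have := (h5 z).1 (Or.inr hz)
            omega
          · omega
          · obtain rfl : y = z := by omega
            exact h4 y ⟨hy, hz⟩
        · intro x
          rw [hT, hD]
          have hs : ((p + 1) :: m' :: t).sum = p + 1 + (m' :: t).sum := by simp
          have hs' : 0 < (m' :: t).sum := by
            have := hk.2 m' (by simp)
            simp; omega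
          rw [hs]
          constructor
          · rintro ((rfl | ⟨y, hy, rfl⟩) | h | ⟨y, hy, rfl⟩)
            · omega
            · have := (h5 y).1 (Or.inl hy)
              omega
            · omega
            · have := (h5 y).1 (Or.inr hy)
              omega
          · rintro ⟨ha, hb⟩
            by_cases hx : x ≤ p
            · exact Or.inr (Or.inl ⟨ha, hx⟩)
            · by_cases hx' : x = p + 1
              · exact Or.inl (Or.inl hx')
              · rcases (h5 (x - (p + 1))).2 (by omega) with h | h
                · exact Or.inl (Or.inr ⟨_, h, by omega⟩)
                · exact Or.inr (Or.inr ⟨_, h, by omega⟩)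
  obtain ⟨k1, k2, k3, k4⟩ := key
  refine ⟨k1, k2, Finset.disjoint_left.2 fun x hx hx' => k3 x ⟨hx, hx'⟩, ?_⟩
  ext x
  rw [Finset.mem_union, k4, Finset.mem_Icc]
  omega

end Apery

end

namespace Apery

open scoped ENNReal NNReal

/-! Both sides are linked by the moments `M(n) = ∑_{N > n₂ > ⋯} N^{-k₁} n₂^{-k₂} ⋯ / (n + N)`. For
real `0 < x < 1` the sum `∑_{n ≥ 0} binom(x+n-1, n) / (n + N)` is the Beta value `B(N, 1-x)`
(`hasSum_risingQuot_div`), so `∑ binom(x+n-1, n) M(n)` is the multiple sum for `k₊` weighted by `N!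
Γ(1-x) / Γ(N+1-x)`. The connected sum method of Seki and Yamamoto moves the parts of `k₊` one unit
at a time through a connector and ends at `ζ((reverse k)^∨₊; 1-x)` (`tsum_mterm_mul_connectorE`).
All terms are nonnegative here, so the work takes place in `ℝ≥0∞`, where sums may be interchanged
freely.

Both sides are locally uniform limits of holomorphic functions on `Re z < 1`. The identity therefore
extends from `(0, 1)` to that half plane (`moment_series_eq_hurwitzMzv`), and Taylor coefficients of
order `q` at `α` may be taken termwise: `binom(z+n-1, n)` contributes the factor `ζ_n({1}_q; α)`
(`taylorCoeff_risingQuot`), and the Hurwitz side contributes the binomial products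
(`taylorCoeff_hurwitzMhs`).

Finally, partial fractions evaluate `M(n)` for `n ≥ 1` through zeta values and star sums
(`moment_eq`). The term `n = 0` is the constant `ζ(k₊)`, which survives only for `q = 0`. -/

/-! ### Multiple sums sliced by their largest variable -/

/-- The part of the multiple sum `∑ c(n₁)^{k₁} ⋯ c(n_r)^{k_r}` over `n₁ > ⋯ > n_r > 0` in which the
largest variable `n₁` is `n`; for the empty index it is concentrated at `n = 0`. -/
def mterm {R : Type*} [CommSemiring R] (c : ℕ → R) : List ℕ → ℕ → R
  | [], n => if n = 0 then 1 else 0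
  | a :: t, n => c n ^ a * ∑ i ∈ Finset.range n, mterm c t i

theorem map_mterm {R S : Type*} [CommSemiring R] [CommSemiring S] (f : R →+* S) (c : ℕ → R)
    (s : List ℕ) (n : ℕ) : f (mterm c s n) = mterm (fun m => f (c m)) s n := by
  induction s generalizing n with
  | nil => by_cases h : n = 0 <;> simp [mterm, h]
  | cons a t ih => simp [mterm, ih]

/-- The value at `0` is always multiplied by an empty sum, so a meaningless `c 0`, such as `1 / (0 -
x)`, is harmless. -/
theorem mterm_congr {R : Type*} [CommSemiring R] {c d : ℕ → R} (h : ∀ m, 1 ≤ m → c m = d m)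
    (s : List ℕ) (n : ℕ) : mterm c s n = mterm d s n := by
  induction s generalizing n with
  | nil => rfl
  | cons a t ih =>
    rcases Nat.eq_zero_or_pos n with rfl | hn
    · simp [mterm]
    · simp [mterm, ih, h n hn]

theorem mterm_cons_zero {R : Type*} [CommSemiring R] (c : ℕ → R) (a : ℕ) (t : List ℕ) :
    mterm c (a :: t) 0 = 0 := by simp [mterm]

theorem mterm_succ_cons {R : Type*} [CommSemiring R] (c : ℕ → R) (a : ℕ) (t : List ℕ) (n : ℕ) :
    mterm c ((a + 1) :: t) n = c n * mterm c (a :: t) n := by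
  simp only [mterm, pow_succ]; ring

theorem hurwitzMhs_eq_sum (α : ℂ) (s : List ℕ) (n : ℕ) :
    hurwitzMhs α n s
      = ∑ m ∈ Finset.range (n + 1), mterm (fun m : ℕ => 1 / ((m : ℂ) + α - 1)) s m := by
  induction s generalizing n with
  | nil => simp [hurwitzMhs, mterm]
  | cons a t ih =>
    rw [Finset.sum_range_succ', mterm_cons_zero, add_zero, hurwitzMhs, Finset.range_eq_Ico,
      Finset.sum_Ico_add' (fun m => mterm (fun m : ℕ => 1 / ((m : ℂ) + α - 1)) (a :: t) m) 0 n 1]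
    refine Finset.sum_congr (by ext; simp) fun m hm => ?_
    obtain ⟨i, rfl⟩ : ∃ i, m = i + 1 := ⟨m - 1, by simp at hm; omega⟩
    simp [mterm, ih]

theorem mhs_eq_hurwitzMhs (s : List ℕ) (n : ℕ) : mhs n s = hurwitzMhs 1 n s := by
  induction s generalizing n with
  | nil => rfl
  | cons a t ih => simp [mhs, hurwitzMhs, ih]

/-! ### Logarithmic bounds and convergence -/

/-- `1 + log n`, a bound for the harmonic numbers. -/
noncomputable def logBound (n : ℕ) : ℝ := 1 + Real.log n

theorem one_le_logBound (n : ℕ) : 1 ≤ logBound n := by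
  have := Real.log_natCast_nonneg n
  unfold logBound; linarith

theorem logBound_nonneg (n : ℕ) : 0 ≤ logBound n := zero_le_one.trans (one_le_logBound n)

theorem logBound_mono : Monotone logBound := by
  intro m n h
  unfold logBound
  rcases Nat.eq_zero_or_pos m with rfl | hm
  · simpa using Real.log_natCast_nonneg n
  · have : (0 : ℝ) < m := by exact_mod_cast hm
    have : (m : ℝ) ≤ n := by exact_mod_cast h
    gcongr

theorem sum_inv_le_logBound (n : ℕ) : ∑ m ∈ Finset.Icc 1 n, (1 : ℝ) / m ≤ logBound n := by
  have := harmonic_le_one_add_log n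
  rw [harmonic_eq_sum_Icc] at this
  push_cast at this
  simpa [logBound] using this

theorem sum_logBound_pow_div_le (p n : ℕ) :
    ∑ m ∈ Finset.Icc 1 n, logBound m ^ p / m ≤ logBound n ^ (p + 1) := by
  calc ∑ m ∈ Finset.Icc 1 n, logBound m ^ p / m
      ≤ ∑ m ∈ Finset.Icc 1 n, logBound n ^ p * ((1 : ℝ) / m) := by
        refine Finset.sum_le_sum fun m hm => ?_
        rw [mul_one_div]
        gcongr
        · exact logBound_nonneg m
        · exact logBound_mono (Finset.mem_Icc.1 hm).2
    _ = logBound n ^ p * ∑ m ∈ Finset.Icc 1 n, (1 : ℝ) / m := by rw [Finset.mul_sum]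
    _ ≤ logBound n ^ p * logBound n := by
        have := logBound_nonneg n
        gcongr
        exact sum_inv_le_logBound n
    _ = _ := by rw [pow_succ]

theorem exists_logBound_pow_le (p : ℕ) {ε : ℝ} (hε : 0 < ε) :
    ∃ C : ℝ, 0 ≤ C ∧ ∀ n : ℕ, 1 ≤ n → logBound n ^ p ≤ C * (n : ℝ) ^ ε := by
  -- The `p`-th power of `n ^ δ` must stay below `n ^ ε`; dividing by `p + 1` also covers `p = 0`.
  set δ := ε / (p + 1) with hδ
  have hδ0 : 0 < δ := by positivity
  refine ⟨(1 + 1 / δ) ^ p, by positivity, fun n hn => ?_⟩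
  have hn1 : (1 : ℝ) ≤ n := by exact_mod_cast hn
  have h1 : logBound n ≤ (1 + 1 / δ) * (n : ℝ) ^ δ := by
    have ha := Real.log_le_rpow_div (x := n) (by positivity) hδ0
    have hb : 1 ≤ (n : ℝ) ^ δ := Real.one_le_rpow hn1 hδ0.le
    unfold logBound
    calc 1 + Real.log n ≤ (n : ℝ) ^ δ + (n : ℝ) ^ δ / δ := by gcongr
      _ = _ := by ring
  calc logBound n ^ p ≤ ((1 + 1 / δ) * (n : ℝ) ^ δ) ^ p := by
        have := logBound_nonneg n
        gcongr
    _ = (1 + 1 / δ) ^ p * (n : ℝ) ^ (δ * p) := by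
        rw [mul_pow, Real.rpow_mul (by positivity), Real.rpow_natCast]
    _ ≤ _ := by
        have : δ * p ≤ ε := by
          rw [hδ, div_mul_eq_mul_div, div_le_iff₀ (by positivity)]
          nlinarith
        gcongr


theorem summable_rpow_mul_logBound_pow (p : ℕ) {e : ℝ} (he : e < -1) :
    Summable fun n : ℕ => (n : ℝ) ^ e * logBound n ^ p := by
  -- Half of the gap between `e` and `-1` absorbs the logarithms, leaving the exponent `(e - 1) / 2
  -- < -1`.
  obtain ⟨C, hC0, hC⟩ := exists_logBound_pow_le p (ε := (-1 - e) / 2) (by linarith)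
  have hs : Summable fun n : ℕ => C * (n : ℝ) ^ ((e - 1) / 2) :=
    (Real.summable_nat_rpow.2 (by linarith)).mul_left C
  refine Summable.of_nonneg_of_le (fun n => ?_) (fun n => ?_) hs
  · have := logBound_nonneg n
    positivity
  · rcases Nat.eq_zero_or_pos n with rfl | hn
    · have h0 : (0 : ℝ) ^ e = 0 := Real.zero_rpow (by linarith)
      rw [Nat.cast_zero, h0, zero_mul]
      exact mul_nonneg hC0 (Real.rpow_nonneg le_rfl _)
    · have hn0 : (0 : ℝ) < n := by exact_mod_cast hn
      calc (n : ℝ) ^ e * logBound n ^ p ≤ (n : ℝ) ^ e * (C * (n : ℝ) ^ ((-1 - e) / 2)) := by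
            gcongr
            exact hC n hn
        _ = C * ((n : ℝ) ^ e * (n : ℝ) ^ ((-1 - e) / 2)) := by ring
        _ = C * (n : ℝ) ^ ((e - 1) / 2) := by
            rw [← Real.rpow_add hn0]; congr 2; ring

theorem norm_mterm_cons_le_aux {c : ℕ → ℂ} {K : ℝ}
    (hc : ∀ m, 1 ≤ m → ‖c m‖ ≤ K / m) {a : ℕ} {t : List ℕ} {B : ℝ} {m : ℕ} (hm : 1 ≤ m)
    (hB : ‖∑ i ∈ Finset.range m, mterm c t i‖ ≤ B) :
    ‖mterm c (a :: t) m‖ ≤ K ^ a / (m : ℝ) ^ a * B := by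
  rw [mterm, norm_mul, norm_pow, ← div_pow]
  have h1 := hc m hm
  have h2 := pow_nonneg ((norm_nonneg _).trans h1) a
  gcongr

/-- Each part `a` costs at most `K ^ a / m`, and each summation over `1 / m` costs one more
logarithm. -/
theorem norm_sum_mterm_le {c : ℕ → ℂ} {K : ℝ} (hK : 0 ≤ K)
    (hc : ∀ m, 1 ≤ m → ‖c m‖ ≤ K / m) (s : List ℕ) (hs : ∀ a ∈ s, 0 < a) (n : ℕ) :
    ‖∑ i ∈ Finset.range (n + 1), mterm c s i‖ ≤ K ^ s.sum * logBound n ^ s.length := by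
  induction s generalizing n with
  | nil => simp [mterm]
  | cons a t ih =>
    rw [Finset.sum_range_succ', mterm_cons_zero, add_zero, Finset.range_eq_Ico,
      Finset.sum_Ico_add' (fun m => mterm c (a :: t) m) 0 n 1]
    have hset : Finset.Ico (0 + 1) (n + 1) = Finset.Icc 1 n := by ext; simp
    rw [hset]
    calc ‖∑ m ∈ Finset.Icc 1 n, mterm c (a :: t) m‖
        ≤ ∑ m ∈ Finset.Icc 1 n, ‖mterm c (a :: t) m‖ := norm_sum_le _ _
      _ ≤ ∑ m ∈ Finset.Icc 1 n, K ^ (a + t.sum) * (logBound m ^ t.length / m) := by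
          refine Finset.sum_le_sum fun m hm => ?_
          have hm1 := (Finset.mem_Icc.1 hm).1
          obtain ⟨i, rfl⟩ : ∃ i, m = i + 1 := ⟨m - 1, by omega⟩
          have h1 : ‖∑ j ∈ Finset.range (i + 1), mterm c t j‖
              ≤ K ^ t.sum * logBound (i + 1) ^ t.length := by
            refine (ih (fun b hb => hs b (by simp [hb])) i).trans ?_
            have := logBound_nonneg i
            gcongr
            exact logBound_mono (by omega)
          refine (norm_mterm_cons_le_aux hc hm1 h1).trans ?_
          have hp : (i + 1 : ℕ) ≤ ((i + 1 : ℕ) : ℝ) ^ a := by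
            have := Nat.le_self_pow (hs a (by simp)).ne' (i + 1)
            exact_mod_cast this
          have := logBound_nonneg (i + 1)
          have hi : (0 : ℝ) < (i + 1 : ℕ) := by positivity
          calc K ^ a / ((i + 1 : ℕ) : ℝ) ^ a * (K ^ t.sum * logBound (i + 1) ^ t.length)
              ≤ K ^ a / ((i + 1 : ℕ) : ℝ) * (K ^ t.sum * logBound (i + 1) ^ t.length) := by
                gcongr
            _ = _ := by rw [pow_add]; ring
      _ ≤ K ^ (a + t.sum) * logBound n ^ (t.length + 1) := by
          rw [← Finset.mul_sum]
          gcongr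
          exact sum_logBound_pow_div_le _ _
      _ = _ := by simp

theorem norm_mterm_cons_le {c : ℕ → ℂ} {K : ℝ} (hK : 0 ≤ K)
    (hc : ∀ m, 1 ≤ m → ‖c m‖ ≤ K / m) (a : ℕ) (t : List ℕ) (hs : ∀ b ∈ t, 0 < b) {m : ℕ}
    (hm : 1 ≤ m) :
    ‖mterm c (a :: t) m‖ ≤ K ^ (a + t.sum) * ((m : ℝ) ^ (-(a : ℝ)) * logBound m ^ t.length) := by
  obtain ⟨i, rfl⟩ : ∃ i, m = i + 1 := ⟨m - 1, by omega⟩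
  have h1 : ‖∑ j ∈ Finset.range (i + 1), mterm c t j‖
      ≤ K ^ t.sum * logBound (i + 1) ^ t.length := by
    refine (norm_sum_mterm_le hK hc t hs i).trans ?_
    have := logBound_nonneg i
    gcongr
    exact logBound_mono (by omega)
  refine (norm_mterm_cons_le_aux hc hm h1).trans (le_of_eq ?_)
  rw [Real.rpow_neg (by positivity), Real.rpow_natCast, pow_add]
  ring

theorem summable_norm_mterm_bound {a : ℕ} (ha : 2 ≤ a) (B : ℝ) (p : ℕ) :
    Summable fun m : ℕ => B * ((m : ℝ) ^ (-(a : ℝ)) * logBound m ^ p) := by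
  refine (summable_rpow_mul_logBound_pow p ?_).mul_left B
  have : (2 : ℝ) ≤ a := by exact_mod_cast ha
  linarith

theorem norm_mterm_cons_le' {c : ℕ → ℂ} {K : ℝ} (hK : 0 ≤ K)
    (hc : ∀ m, 1 ≤ m → ‖c m‖ ≤ K / m) {a : ℕ} (ha : a ≠ 0) (t : List ℕ) (hs : ∀ b ∈ t, 0 < b)
    (m : ℕ) :
    ‖mterm c (a :: t) m‖ ≤ K ^ (a + t.sum) * ((m : ℝ) ^ (-(a : ℝ)) * logBound m ^ t.length) := by
  rcases Nat.eq_zero_or_pos m with rfl | hm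
  · rw [mterm_cons_zero, Nat.cast_zero, Real.zero_rpow (by simpa using ha)]
    simp
  · exact norm_mterm_cons_le hK hc a t hs hm

theorem summable_norm_mterm {c : ℕ → ℂ} {K : ℝ} (hK : 0 ≤ K)
    (hc : ∀ m, 1 ≤ m → ‖c m‖ ≤ K / m) {s : List ℕ} (hs : IsAdmissible s) :
    Summable fun m => ‖mterm c s m‖ := by
  cases s with
  | nil =>
    refine summable_of_ne_finset_zero (s := {0}) fun m hm => ?_
    have : m ≠ 0 := by simpa using hm
    simp [mterm, this]
  | cons a t =>
    have ha : 2 ≤ a := hs.2 a (by simp)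
    exact Summable.of_nonneg_of_le (fun m => norm_nonneg _)
      (norm_mterm_cons_le' hK hc (by omega) t fun b hb => hs.1 b (by simp [hb]))
      (summable_norm_mterm_bound ha _ _)

theorem hasSum_hurwitz {β : ℂ} {K : ℝ} (hK : 0 ≤ K)
    (hc : ∀ m : ℕ, 1 ≤ m → ‖1 / ((m : ℂ) + β - 1)‖ ≤ K / m) {s : List ℕ} (hs : IsAdmissible s) :
    HasSum (mterm (fun m : ℕ => 1 / ((m : ℂ) + β - 1)) s) (hurwitzMzv β s) ∧
      Tendsto (fun n => hurwitzMhs β n s) atTop (𝓝 (hurwitzMzv β s)) := by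
  have h1 := (summable_norm_mterm hK hc hs).of_norm.hasSum
  have h2 : Tendsto (fun n => hurwitzMhs β n s) atTop
      (𝓝 (∑' m, mterm (fun m : ℕ => 1 / ((m : ℂ) + β - 1)) s m)) := by
    simp only [hurwitzMhs_eq_sum]
    exact h1.tendsto_sum_nat.comp (tendsto_add_atTop_nat 1)
  have h3 := h2.limUnder_eq
  rw [hurwitzMzv, h3]
  exact ⟨h1, h2⟩

/-- The real part of `m - z` is at least `m - 1 + δ`, which is at least `δ m` because `m ≥ 1` and `δ
≤ 1`. The bound is uniform in `z`, as the M-test needs. -/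
theorem norm_hcoef_le {z : ℂ} {δ : ℝ} (hδ : 0 < δ) (hδ1 : δ ≤ 1) (hz : z.re ≤ 1 - δ) {m : ℕ}
    (hm : 1 ≤ m) : ‖1 / ((m : ℂ) + (1 - z) - 1)‖ ≤ δ⁻¹ / m := by
  have hm1 : (1 : ℝ) ≤ m := by exact_mod_cast hm
  have h1 : δ * m ≤ ‖(m : ℂ) + (1 - z) - 1‖ := by
    refine le_trans ?_ (Complex.re_le_norm _)
    simp
    nlinarith
  rw [norm_div, norm_one, inv_div_left, ← one_div, mul_comm]
  gcongr

theorem hasSum_hurwitz_of_re_lt {α : ℂ} (hre : α.re < 1) {s : List ℕ} (hs : IsAdmissible s) :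
    HasSum (mterm (fun m : ℕ => 1 / ((m : ℂ) + (1 - α) - 1)) s) (hurwitzMzv (1 - α) s) ∧
      Tendsto (fun n => hurwitzMhs (1 - α) n s) atTop (𝓝 (hurwitzMzv (1 - α) s)) := by
  have h0 : 0 < min 1 (1 - α.re) := lt_min one_pos (by linarith)
  refine hasSum_hurwitz (inv_nonneg.2 h0.le) (fun m hm => norm_hcoef_le h0 (min_le_left _ _) ?_ hm)
    hs
  have := min_le_right 1 (1 - α.re)
  linarith

theorem mzv_eq_hurwitzMzv (s : List ℕ) : mzv s = hurwitzMzv (1 - 0) s := by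
  simp [mzv, hurwitzMzv, mhs_eq_hurwitzMhs]

theorem tendsto_mhs {s : List ℕ} (hs : IsAdmissible s) :
    Tendsto (fun n => mhs n s) atTop (𝓝 (mzv s)) := by
  have := (hasSum_hurwitz_of_re_lt (α := 0) (by simp) hs).2
  rw [← mzv_eq_hurwitzMzv] at this
  simpa [mhs_eq_hurwitzMhs] using this

/-! ### The connector and its telescoping sums -/

/-- The factors are at most `1 / (1 + y / (i + 1))`, so the product is at most `1 / (1 + y H_n)`,
and the harmonic series diverges. -/
theorem tendsto_prod_zero_of_le {u : ℕ → ℝ} {y : ℝ} (hy : 0 < y) (h0 : ∀ i, 0 ≤ u i)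
    (h1 : ∀ i : ℕ, u i * (i + 1 + y) ≤ i + 1) :
    Tendsto (fun n => ∏ i ∈ Finset.range n, u i) atTop (𝓝 0) := by
  have key : ∀ n, (∏ i ∈ Finset.range n, u i)
      * (1 + y * ∑ i ∈ Finset.range n, (1 : ℝ) / (i + 1)) ≤ 1 := by
    intro n
    induction n with
    | zero => simp
    | succ n ih =>
      refine le_trans ?_ ih
      rw [Finset.prod_range_succ, Finset.sum_range_succ, mul_assoc]
      have hp : 0 ≤ ∏ i ∈ Finset.range n, u i := Finset.prod_nonneg fun i _ => h0 i
      refine mul_le_mul_of_nonneg_left ?_ hp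
      set S := ∑ i ∈ Finset.range n, (1 : ℝ) / (i + 1)
      have hS : 0 ≤ S := Finset.sum_nonneg fun i _ => by positivity
      have hn : (0 : ℝ) < n + 1 := by positivity
      have h2 : u n * (1 + y / (n + 1)) ≤ 1 := by
        have h3 := h1 n
        have e : u n * (1 + y / (n + 1)) = u n * (n + 1 + y) / (n + 1) := by field_simp
        rw [e, div_le_one hn]
        exact h3
      have h4 : u n ≤ 1 := by
        have : 0 ≤ u n * (y / (n + 1)) := mul_nonneg (h0 n) (by positivity)
        linarith
      have h5 : u n * (y * S) ≤ y * S := mul_le_of_le_one_left (by positivity) h4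
      calc u n * (1 + y * (S + 1 / (n + 1))) = u n * (1 + y / (n + 1)) + u n * (y * S) := by ring
        _ ≤ _ := by linarith
  have hlim : Tendsto (fun n => (1 + y * ∑ i ∈ Finset.range n, (1 : ℝ) / (i + 1))⁻¹) atTop
      (𝓝 0) := by
    refine tendsto_inv_atTop_zero.comp ?_
    exact tendsto_atTop_add_const_left _ _
      (Real.tendsto_sum_range_one_div_nat_succ_atTop.const_mul_atTop hy)
  refine squeeze_zero (fun n => Finset.prod_nonneg fun i _ => h0 i) (fun n => ?_) hlim
  have hS : 0 ≤ ∑ i ∈ Finset.range n, (1 : ℝ) / (i + 1) :=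
    Finset.sum_nonneg fun i _ => by positivity
  rw [← one_div, le_div_iff₀ (by positivity)]
  exact key n

/-- The connector `n! Γ(m + 1 - x) / Γ(n + m + 1 - x)`. -/
noncomputable def connector (x : ℝ) (n m : ℕ) : ℝ :=
  ∏ i ∈ Finset.range n, ((i : ℝ) + 1) / (i + 1 + m - x)

theorem tendsto_connector_right (x : ℝ) {n : ℕ} (hn : 1 ≤ n) :
    Tendsto (fun m => connector x n m) atTop (𝓝 0) := by
  have h : ∀ i : ℕ, Tendsto (fun m : ℕ => ((i : ℝ) + 1) / (i + 1 + m - x)) atTop (𝓝 0) := by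
    intro i
    refine tendsto_const_nhds.div_atTop ?_
    simp only [add_sub_assoc]
    refine tendsto_atTop_add_const_left _ _ ?_
    simp only [sub_eq_add_neg]
    exact tendsto_atTop_add_const_right _ _ tendsto_natCast_atTop_atTop
  have := tendsto_finsetProd (Finset.range n) fun i _ => h i
  simpa [connector, Finset.prod_const, show n ≠ 0 by omega] using this

section Connector

variable {x : ℝ} (hx : x < 1)
include hx

theorem connector_denom_pos (i m : ℕ) : 0 < (i : ℝ) + 1 + m - x := by
  have : (0 : ℝ) ≤ i := by positivity
  have : (0 : ℝ) ≤ m := by positivity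
  linarith

theorem connector_nonneg (n m : ℕ) : 0 ≤ connector x n m :=
  Finset.prod_nonneg fun i _ => div_nonneg (by positivity) (connector_denom_pos hx i m).le

/-- Writing `C` for the connector, this gives `C(n+1,m) / (n+1) = (C(n,m) - C(n+1,m)) / (m-x)`, and
the right shift gives `C(n,m+1) / (m+1-x) = (C(n,m) - C(n,m+1)) / n`. Both telescope. -/
theorem connector_shift_left (n m : ℕ) :
    connector x (n + 1) m * ((n + 1 + m - x) / (n + 1)) = connector x n m := by
  have := (connector_denom_pos hx n m).ne'
  rw [connector, Finset.prod_range_succ, ← connector]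
  field_simp

theorem connector_shift_right (n m : ℕ) :
    connector x n (m + 1) * ((n + m + 1 - x) / (m + 1 - x)) = connector x n m := by
  induction n with
  | zero =>
    have := (connector_denom_pos hx m 0).ne'
    have : (m : ℝ) + 1 - x ≠ 0 := by simpa using this
    simp [connector]
    field_simp
    exact this
  | succ n ih =>
    have h1 := (connector_denom_pos hx n m).ne'
    have h2 : (m : ℝ) + 1 - x ≠ 0 := by simpa using (connector_denom_pos hx m 0).ne'
    have h3 := (connector_denom_pos hx n (m + 1)).ne'
    rw [connector, connector, Finset.prod_range_succ, Finset.prod_range_succ, ← connector,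
      ← connector, ← ih]
    push_cast at *
    have h4 : (n : ℝ) + 1 + m + 1 - x ≠ 0 := by
      rwa [show (n : ℝ) + 1 + m + 1 - x = n + 1 + (m + 1) - x by ring]
    have h5 : (n : ℝ) + 1 + (m + 1) - x = (n : ℝ) + 1 + m + 1 - x := by ring
    rw [h5]
    field_simp
    ring

theorem tendsto_connector_left {m : ℕ} (hm : 1 ≤ m) :
    Tendsto (fun n => connector x n m) atTop (𝓝 0) := by
  have hm1 : (1 : ℝ) ≤ m := by exact_mod_cast hm
  refine tendsto_prod_zero_of_le (y := m - x) (by linarith)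
    (fun i => div_nonneg (by positivity) (connector_denom_pos hx i m).le) fun i => ?_
  have := (connector_denom_pos hx i m).ne'
  rw [show (i : ℝ) + 1 + (m - x) = i + 1 + m - x by ring, div_mul_cancel₀ _ this]

theorem hasSum_connector_left (n : ℕ) {m : ℕ} (hm : 1 ≤ m) :
    HasSum (fun a : ℕ => 1 / ((a + (n + 1) : ℕ) : ℝ) * connector x (a + (n + 1)) m)
      (1 / (m - x) * connector x n m) := by
  have hm1 : (1 : ℝ) ≤ m := by exact_mod_cast hm
  have hmx : 0 < m - x := by linarith
  rw [hasSum_iff_tendsto_nat_of_nonneg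
    (fun i => mul_nonneg (by positivity) (connector_nonneg hx _ _))]
  have h : ∀ N, ∑ a ∈ Finset.range N, 1 / ((a + (n + 1) : ℕ) : ℝ) * connector x (a + (n + 1)) m
      = 1 / (m - x) * (connector x n m - connector x (N + n) m) := by
    intro N
    induction N with
    | zero => simp
    | succ N ih =>
      rw [Finset.sum_range_succ, ih, ← connector_shift_left hx (N + n) m,
        show N + (n + 1) = N + n + 1 by ring, show N + 1 + n = N + n + 1 by ring]
      push_cast
      field_simp
      ring
  simp only [h]
  have := ((tendsto_connector_left hx hm).comp (tendsto_add_atTop_nat n)).const_sub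
    (connector x n m) |>.const_mul (1 / (m - x))
  simpa using this

theorem hasSum_connector_right {n : ℕ} (hn : 1 ≤ n) (m : ℕ) :
    HasSum (fun b : ℕ => 1 / (((b + (m + 1) : ℕ) : ℝ) - x) * connector x n (b + (m + 1)))
      (1 / (n : ℝ) * connector x n m) := by
  have hn1 : (0 : ℝ) < n := by exact_mod_cast hn
  have hd : ∀ b : ℕ, 0 < ((b + (m + 1) : ℕ) : ℝ) - x := fun b => by
    have := connector_denom_pos hx b m
    push_cast
    linarith
  rw [hasSum_iff_tendsto_nat_of_nonneg
    (fun i => mul_nonneg (one_div_nonneg.2 (hd i).le) (connector_nonneg hx _ _))]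
  have h : ∀ N, ∑ b ∈ Finset.range N,
      1 / (((b + (m + 1) : ℕ) : ℝ) - x) * connector x n (b + (m + 1))
      = 1 / (n : ℝ) * (connector x n m - connector x n (N + m)) := by
    intro N
    induction N with
    | zero => simp
    | succ N ih =>
      have h1 := (hd N).ne'
      rw [Finset.sum_range_succ, ih, ← connector_shift_right hx n (N + m)]
      rw [show N + (m + 1) = N + m + 1 by ring] at h1 ⊢
      rw [show N + 1 + m = N + m + 1 by ring]
      push_cast at h1 ⊢
      field_simp
      ring
  simp only [h]
  have := ((tendsto_connector_right x hn).comp (tendsto_add_atTop_nat m)).const_sub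
    (connector x n m) |>.const_mul (1 / (n : ℝ))
  simpa using this

end Connector

/-! ### Connected sums and the Hoffman dual -/

theorem tsum_ite_lt_ofReal {f : ℕ → ℝ} {S : ℝ} {n : ℕ} (h : HasSum (fun a => f (a + (n + 1))) S)
    (hf : ∀ a, 0 ≤ f (a + (n + 1))) :
    ∑' a, (if n < a then ENNReal.ofReal (f a) else 0) = ENNReal.ofReal S := by
  have h1 (F : ℕ → ℝ≥0∞) : ∑ i ∈ Finset.range (n + 1), F i + ∑' i, F (i + (n + 1)) = ∑' i, F i :=
    Summable.sum_add_tsum_nat_add' ENNReal.summable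
  rw [← h1, Finset.sum_eq_zero, zero_add, ← h.tsum_eq,
    ENNReal.ofReal_tsum_of_nonneg hf h.summable]
  · exact tsum_congr fun a => by rw [if_pos (by omega)]
  · intro i hi
    rw [if_neg (by simp at hi; omega)]

theorem tsum_mul_tsum_ite_lt (v D : ℕ → ℝ≥0∞) :
    ∑' m, v m * ∑' b, (if m < b then D b else 0)
      = ∑' b, (∑ i ∈ Finset.range b, v i) * D b := by
  simp only [← ENNReal.tsum_mul_left]
  rw [ENNReal.tsum_comm]
  refine tsum_congr fun b => ?_
  rw [Finset.sum_mul, tsum_eq_sum (s := Finset.range b)]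
  · exact Finset.sum_congr rfl fun i hi => by rw [if_pos (Finset.mem_range.1 hi)]
  · intro i hi
    rw [if_neg (by simpa using hi), mul_zero]

/-- The reciprocals `1 / (n - x)` as extended nonnegative reals. -/
noncomputable def recip (x : ℝ) (n : ℕ) : ℝ≥0∞ := ENNReal.ofReal (1 / (n - x))

noncomputable def connectorE (x : ℝ) (n m : ℕ) : ℝ≥0∞ := ENNReal.ofReal (connector x n m)

/-- The connected sum of Seki and Yamamoto, shifted by `x` in one family of variables. -/
noncomputable def connectedSum (x : ℝ) (k l : List ℕ) : ℝ≥0∞ :=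
  ∑' n, ∑' m, mterm (recip 0) k n * mterm (recip x) l m * connectorE x n m

section ConnectedSum

variable {x : ℝ} (hx : x < 1)
include hx

theorem recip_mul_connectorE_right {n : ℕ} (hn : 1 ≤ n) (m : ℕ) :
    recip 0 n * connectorE x n m
      = ∑' b, if m < b then recip x b * connectorE x n b else 0 := by
  have h := tsum_ite_lt_ofReal (f := fun b => 1 / ((b : ℝ) - x) * connector x n b)
    (hasSum_connector_right hx hn m) fun b => by
      have := connector_denom_pos hx b m
      refine mul_nonneg (one_div_nonneg.2 ?_) (connector_nonneg hx _ _)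
      push_cast
      linarith
  rw [recip, connectorE, sub_zero, ← ENNReal.ofReal_mul (by positivity), ← h]
  refine tsum_congr fun b => ?_
  split_ifs with hb
  · have : (1 : ℝ) ≤ b := by exact_mod_cast (by omega : 1 ≤ b)
    rw [recip, connectorE, ← ENNReal.ofReal_mul (one_div_nonneg.2 (by linarith))]
  · rfl

theorem recip_mul_connectorE_left (n : ℕ) {m : ℕ} (hm : 1 ≤ m) :
    recip x m * connectorE x n m
      = ∑' a, if n < a then recip 0 a * connectorE x a m else 0 := by
  have h := tsum_ite_lt_ofReal (f := fun a => 1 / (a : ℝ) * connector x a m)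
    (hasSum_connector_left hx n hm) fun b =>
      mul_nonneg (by positivity) (connector_nonneg hx _ _)
  have hm1 : (1 : ℝ) ≤ m := by exact_mod_cast hm
  rw [recip, connectorE, ← ENNReal.ofReal_mul (one_div_nonneg.2 (by linarith)), ← h]
  refine tsum_congr fun b => ?_
  split_ifs with hb
  · rw [recip, connectorE, sub_zero, ← ENNReal.ofReal_mul (by positivity)]
  · rfl

/-- One factor `1 / n` on the left is traded for a new largest variable on the right. The slice `n =
0`, where the trade fails, contributes nothing. -/
theorem connectedSum_move (a : ℕ) (t l : List ℕ) :
    connectedSum x ((a + 1) :: t) l = connectedSum x (a :: t) (1 :: l) := by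
  refine tsum_congr fun n => ?_
  rcases Nat.eq_zero_or_pos n with rfl | hn
  · simp [mterm_cons_zero]
  calc ∑' m, mterm (recip 0) ((a + 1) :: t) n * mterm (recip x) l m * connectorE x n m
      = ∑' m, mterm (recip 0) (a :: t) n * (mterm (recip x) l m
          * ∑' b, if m < b then recip x b * connectorE x n b else 0) := by
        refine tsum_congr fun m => ?_
        rw [← recip_mul_connectorE_right hx hn, mterm_succ_cons]
        ring
    _ = _ := by
        rw [ENNReal.tsum_mul_left, tsum_mul_tsum_ite_lt, ← ENNReal.tsum_mul_left]
        refine tsum_congr fun b => ?_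
        rw [mterm.eq_2 (recip x), pow_one]
        ring

/-- The trade in the opposite direction: one factor `1 / (m - x)` on the right is exchanged for a
new largest variable on the left. -/
theorem connectedSum_absorb (t : List ℕ) (b : ℕ) (l : List ℕ) :
    connectedSum x (1 :: t) (b :: l) = connectedSum x t ((b + 1) :: l) := by
  rw [connectedSum, connectedSum, ENNReal.tsum_comm]
  conv_rhs => rw [ENNReal.tsum_comm]
  refine tsum_congr fun m => ?_
  rcases Nat.eq_zero_or_pos m with rfl | hm
  · simp [mterm_cons_zero]
  symm
  calc ∑' n, mterm (recip 0) t n * mterm (recip x) ((b + 1) :: l) m * connectorE x n m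
      = ∑' n, mterm (recip x) (b :: l) m * (mterm (recip 0) t n
          * ∑' a, if n < a then recip 0 a * connectorE x a m else 0) := by
        refine tsum_congr fun n => ?_
        rw [← recip_mul_connectorE_left hx n hm, mterm_succ_cons]
        ring
    _ = _ := by
        rw [ENNReal.tsum_mul_left, tsum_mul_tsum_ite_lt, ← ENNReal.tsum_mul_left]
        refine tsum_congr fun b => ?_
        rw [mterm.eq_2 (recip 0), pow_one]
        ring

theorem connectedSum_move_ones (a : ℕ) (t l : List ℕ) :
    connectedSum x ((a + 1) :: t) l = connectedSum x (1 :: t) (List.replicate a 1 ++ l) := by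
  induction a generalizing l with
  | zero => rfl
  | succ a ih =>
    rw [connectedSum_move hx, ih, List.replicate_succ', List.append_assoc, List.singleton_append]

/-- A whole part `a` crosses over: `a - 1` moves prepend ones, then the remaining `1` is absorbed.
The absorption needs a leading entry on the right. -/
theorem connectedSum_cons {a : ℕ} (ha : 0 < a) (t : List ℕ) {l : List ℕ} (hl : l ≠ []) :
    connectedSum x (a :: t) l = connectedSum x t (addHead (List.replicate (a - 1) 1 ++ l)) := by
  obtain ⟨a, rfl⟩ : ∃ b, a = b + 1 := ⟨a - 1, by omega⟩
  rw [connectedSum_move_ones hx, Nat.add_sub_cancel]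
  cases h : List.replicate a 1 ++ l with
  | nil => exact absurd (List.append_eq_nil_iff.1 h).2 hl
  | cons b l' => exact connectedSum_absorb hx t b l'

theorem connectedSum_foldl (k : List ℕ) (hk : ∀ a ∈ k, 0 < a) {l : List ℕ} (hl : l ≠ []) :
    connectedSum x k l = connectedSum x []
      (k.foldl (fun l a => addHead (List.replicate (a - 1) 1 ++ l)) l) := by
  induction k generalizing l with
  | nil => rfl
  | cons a t ih =>
    rw [connectedSum_cons hx (hk a (by simp)) t hl, List.foldl_cons,
      ih fun b hb => hk b (by simp [hb])]
    cases h : List.replicate (a - 1) 1 ++ l with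
    | nil => exact absurd (List.append_eq_nil_iff.1 h).2 hl
    | cons b l' => simp [addHead]

end ConnectedSum

/-- The transport reads `k` from the left, the recursion for the dual of the reversed list from the
right; hence the induction appends entries at the end. -/
theorem addHead_hoffmanDual_reverse (k : List ℕ) (hk : IsComposition k) :
    addHead (hoffmanDual k.reverse)
      = k.foldl (fun l a => addHead (List.replicate (a - 1) 1 ++ l)) [1] := by
  obtain ⟨hne, hpos⟩ := hk
  induction k using List.reverseRecOn with
  | nil => exact absurd rfl hne
  | append_singleton t a ih =>
    rw [List.reverse_append, List.foldl_append, List.reverse_singleton, List.singleton_append,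
      List.foldl_cons, List.foldl_nil]
    have ha : 0 < a := hpos a (by simp)
    rcases eq_or_ne t [] with rfl | ht
    · simp only [List.reverse_nil, hoffmanDual, List.foldl_nil]
      rw [← List.replicate_succ', Nat.sub_add_cancel ha]
    · rw [← ih ht fun b hb => hpos b (by simp [hb])]
      cases h : t.reverse with
      | nil => exact absurd (List.reverse_eq_nil_iff.1 h) ht
      | cons b s => rfl

theorem connectedSum_nil_left (x : ℝ) (l : List ℕ) :
    connectedSum x [] l = ∑' m, mterm (recip x) l m := by
  rw [connectedSum, tsum_eq_single 0]
  · simp [mterm, connectorE, connector]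
  · intro n hn
    simp [mterm, hn]

theorem connectedSum_nil_right (x : ℝ) (k : List ℕ) :
    connectedSum x k [] = ∑' n, mterm (recip 0) k n * connectorE x n 0 := by
  refine tsum_congr fun n => ?_
  rw [tsum_eq_single 0]
  · simp [mterm]
  · intro m hm
    simp [mterm, hm]

theorem tsum_mterm_mul_connectorE {x : ℝ} (hx : x < 1) {k : List ℕ} (hk : IsComposition k) :
    ∑' n, mterm (recip 0) (addHead k) n * connectorE x n 0
      = ∑' m, mterm (recip x) (addHead (hoffmanDual k.reverse)) m := by
  rw [← connectedSum_nil_right, ← connectedSum_nil_left, addHead_hoffmanDual_reverse k hk,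
    ← connectedSum_foldl hx k hk.2 (by simp)]
  -- The extra unit in `k₊` crosses first and supplies the initial list `[1]`.
  cases k with
  | nil => exact absurd rfl hk.1
  | cons a t => exact connectedSum_move hx a t []

/-! ### Binomial expansion of the connector -/

/-- The binomial coefficient `binom(z + n - 1, n)` as a polynomial in `z`. -/
noncomputable def risingQuot {R : Type*} [Field R] (z : R) (n : ℕ) : R :=
  ∏ i ∈ Finset.range n, (z + i) / ((i : R) + 1)

theorem risingQuot_succ {R : Type*} [Field R] (z : R) (n : ℕ) :
    risingQuot z (n + 1) = risingQuot z n * ((z + n) / ((n : R) + 1)) := Finset.prod_range_succ _ _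

section RisingQuot

variable {x : ℝ} (hx0 : 0 < x) (hx : x < 1)
include hx0

theorem risingQuot_nonneg (n : ℕ) : 0 ≤ risingQuot x n :=
  Finset.prod_nonneg fun i _ => by positivity

include hx

theorem tendsto_risingQuot_zero : Tendsto (risingQuot x) atTop (𝓝 0) := by
  refine tendsto_prod_zero_of_le (y := 1 - x) (by linarith) (fun i => by positivity) fun i => ?_
  rw [div_mul_eq_mul_div, div_le_iff₀ (by positivity)]
  nlinarith [sq_nonneg (1 - x)]

/-- This is `∫₀¹ t^N (1-t)^{-x} dt = B(N+1, 1-x)` with the binomial series integrated termwise. The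
proof avoids integrals: partial sums have a closed form for `N = 0` and satisfy a recurrence in `N`.
-/
theorem hasSum_risingQuot_div (N : ℕ) :
    HasSum (fun n : ℕ => risingQuot x n * (1 / ((n : ℝ) + (N + 1 : ℕ))))
      (1 / ((N + 1 : ℕ) : ℝ) * connector x (N + 1) 0) := by
  have hP := tendsto_risingQuot_zero hx0 hx
  have hnn : ∀ N : ℕ, ∀ n, 0 ≤ risingQuot x n * (1 / ((n : ℝ) + (N + 1 : ℕ))) := fun N n =>
    mul_nonneg (risingQuot_nonneg hx0 n) (by positivity)
  induction N with
  | zero =>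
    rw [hasSum_iff_tendsto_nat_of_nonneg (hnn 0)]
    have h : ∀ M, ∑ n ∈ Finset.range M, risingQuot x n * (1 / ((n : ℝ) + (0 + 1 : ℕ)))
        = (1 - risingQuot x M) / (1 - x) := by
      intro M
      induction M with
      | zero => simp [risingQuot]
      | succ M ih =>
        have h1 : 1 - x ≠ 0 := by linarith
        rw [Finset.sum_range_succ, ih, risingQuot_succ]
        push_cast
        field_simp
        ring
    simp only [h]
    have := (hP.const_sub 1).div_const (1 - x)
    simpa [connector] using this
  | succ N ih =>
    have hd := (connector_denom_pos hx (N + 1) 0).ne'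
    have hN : (N : ℝ) + 1 + 1 - x ≠ 0 := by simpa using hd
    have hN' : (N : ℝ) + 2 - x ≠ 0 := by rwa [show (N : ℝ) + 2 - x = N + 1 + 1 - x by ring]
    -- The finite form of `(N+2-x) B(N+2, 1-x) = (N+1) B(N+1, 1-x)`; the boundary term vanishes in
    -- the limit.
    have h : ∀ M : ℕ, ∑ n ∈ Finset.range M, risingQuot x n * (1 / ((n : ℝ) + (N + 1 + 1 : ℕ)))
        = (N + 2 - x)⁻¹ * ((N + 1)
            * ∑ n ∈ Finset.range M, risingQuot x n * (1 / ((n : ℝ) + (N + 1 : ℕ)))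
          - M * (risingQuot x M * (1 / ((M : ℝ) + (N + 1 : ℕ))))) := by
      intro M
      induction M with
      | zero => simp
      | succ M ihM =>
        rw [Finset.sum_range_succ, Finset.sum_range_succ, ihM, risingQuot_succ]
        push_cast
        field_simp
        ring
    have hg : Tendsto (fun M : ℕ => (M : ℝ) * (risingQuot x M * (1 / ((M : ℝ) + (N + 1 : ℕ)))))
        atTop (𝓝 0) := by
      refine squeeze_zero (fun M => mul_nonneg (by positivity) (hnn N M)) (fun M => ?_) hP
      have h1 := risingQuot_nonneg hx0 M
      have h2 : (M : ℝ) / (M + (N + 1 : ℕ)) ≤ 1 := by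
        rw [div_le_one (by positivity)]
        exact le_add_of_nonneg_right (by positivity)
      calc (M : ℝ) * (risingQuot x M * (1 / ((M : ℝ) + (N + 1 : ℕ))))
          = risingQuot x M * (M / (M + (N + 1 : ℕ))) := by ring
        _ ≤ risingQuot x M := mul_le_of_le_one_right h1 h2
    rw [hasSum_iff_tendsto_nat_of_nonneg (hnn (N + 1))]
    simp only [h]
    have h2 := ((ih.tendsto_sum_nat.const_mul ((N : ℝ) + 1)).sub hg).const_mul ((N + 2 - x)⁻¹)
    convert h2 using 2
    rw [connector, Finset.prod_range_succ, ← connector]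
    push_cast
    rw [show (N : ℝ) + 1 + 1 + 0 - x = N + 2 - x by ring]
    field_simp
    ring

theorem tsum_risingQuot_mul {N : ℕ} (hN : 1 ≤ N) :
    ∑' n : ℕ, ENNReal.ofReal (risingQuot x n) * ENNReal.ofReal (1 / ((n : ℝ) + N))
      = recip 0 N * connectorE x N 0 := by
  obtain ⟨N, rfl⟩ : ∃ M, N = M + 1 := ⟨N - 1, by omega⟩
  have h := hasSum_risingQuot_div hx0 hx N
  rw [recip, connectorE, sub_zero, ← ENNReal.ofReal_mul (by positivity), ← h.tsum_eq,
    ENNReal.ofReal_tsum_of_nonneg (fun n => mul_nonneg (risingQuot_nonneg hx0 n) (by positivity))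
      h.summable]
  exact tsum_congr fun n => (ENNReal.ofReal_mul (risingQuot_nonneg hx0 n)).symm

end RisingQuot

/-! ### Moments and their partial fraction evaluation -/

/-- The moment `∑_{N > n₂ > ⋯} 1 / (N^{k₁} n₂^{k₂} ⋯) · 1 / (n + N)`. -/
noncomputable def momentE (k : List ℕ) (n : ℕ) : ℝ≥0∞ :=
  ∑' N : ℕ, mterm (recip 0) k N * ENNReal.ofReal (1 / ((n : ℝ) + N))

/-- Summing over `n` first produces `1 / N` times the connector at `(N, 0)`; the factor `1 / N`
turns `k` into `k₊`. -/
theorem tsum_risingQuot_mul_momentE {x : ℝ} (hx0 : 0 < x) (hx : x < 1) {k : List ℕ}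
    (hk : IsComposition k) :
    ∑' n, ENNReal.ofReal (risingQuot x n) * momentE k n
      = ∑' m, mterm (recip x) (addHead (hoffmanDual k.reverse)) m := by
  rw [← tsum_mterm_mul_connectorE hx hk]
  obtain ⟨a, t, rfl⟩ := List.exists_cons_of_ne_nil hk.1
  simp only [momentE, ← ENNReal.tsum_mul_left]
  rw [ENNReal.tsum_comm]
  refine tsum_congr fun N => ?_
  rcases Nat.eq_zero_or_pos N with rfl | hN
  · simp [addHead, mterm_cons_zero]
  rw [addHead, mterm_succ_cons, mul_right_comm, ← tsum_risingQuot_mul hx0 hx hN,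
    ← ENNReal.tsum_mul_right]
  exact tsum_congr fun n => by ring

/-- Nonnegative reals map by ring homomorphisms both to `ℝ≥0∞` and to `ℂ`, so `map_mterm` can
compare the two. -/
theorem mterm_recip (x : ℝ) (s : List ℕ) (m : ℕ) :
    mterm (recip x) s m = (mterm (fun m : ℕ => (1 / ((m : ℝ) - x)).toNNReal) s m : ℝ≥0) :=
  (map_mterm ENNReal.ofNNRealHom _ s m).symm

theorem ofReal_mterm_toNNReal {x : ℝ} (hx : x < 1) (s : List ℕ) (m : ℕ) :
    (((mterm (fun m : ℕ => (1 / ((m : ℝ) - x)).toNNReal) s m : ℝ≥0) : ℝ) : ℂ)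
      = mterm (fun m : ℕ => 1 / ((m : ℂ) + (1 - x) - 1)) s m := by
  have h := map_mterm (Complex.ofRealHom.comp NNReal.toRealHom)
    (fun m : ℕ => (1 / ((m : ℝ) - x)).toNNReal) s m
  refine Eq.trans h (mterm_congr (fun m hm => ?_) s m)
  have hm1 : (1 : ℝ) ≤ m := by exact_mod_cast hm
  have h0 : 0 ≤ 1 / ((m : ℝ) - x) := one_div_nonneg.2 (by linarith)
  simp only [RingHom.coe_comp, Function.comp_apply, NNReal.coe_toRealHom,
    Real.coe_toNNReal _ h0, Complex.ofRealHom_eq_coe]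
  push_cast
  congr 1
  ring

theorem tsum_mterm_recip {x : ℝ} (hx : x < 1) {s : List ℕ} (hs : IsAdmissible s) :
    ∑' m, mterm (recip x) s m ≠ ⊤ ∧
      ((∑' m, mterm (recip x) s m).toReal : ℂ) = hurwitzMzv (1 - x) s := by
  have h := (hasSum_hurwitz_of_re_lt (α := (x : ℂ)) (by simpa using hx) hs).1
  have h1 : (fun m => mterm (fun m : ℕ => 1 / ((m : ℂ) + (1 - x) - 1)) s m)
      = fun m => (((mterm (fun m : ℕ => (1 / ((m : ℝ) - x)).toNNReal) s m : ℝ≥0) : ℝ) : ℂ) :=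
    funext fun m => (ofReal_mterm_toNNReal hx s m).symm
  have hsum : Summable (mterm (fun m : ℕ => (1 / ((m : ℝ) - x)).toNNReal) s) := by
    rw [← NNReal.summable_coe, ← Complex.summable_ofReal, ← h1]
    exact h.summable
  have h2 : ∑' m, mterm (recip x) s m
      = (∑' m, mterm (fun m : ℕ => (1 / ((m : ℝ) - x)).toNNReal) s m : ℝ≥0) := by
    rw [ENNReal.coe_tsum hsum]
    exact tsum_congr fun m => mterm_recip x s m
  rw [h2]
  refine ⟨ENNReal.coe_ne_top, ?_⟩
  rw [ENNReal.coe_toReal, NNReal.coe_tsum, Complex.ofReal_tsum, ← h.tsum_eq]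
  exact tsum_congr fun m => ofReal_mterm_toNNReal hx s m

/-- The multiple zeta value as an extended nonnegative real. -/
noncomputable def mzvE (s : List ℕ) : ℝ≥0∞ := ∑' m, mterm (recip 0) s m

theorem mzvE_ne_top {s : List ℕ} (hs : IsAdmissible s) : mzvE s ≠ ⊤ :=
  (tsum_mterm_recip zero_lt_one hs).1

theorem toReal_mzvE {s : List ℕ} (hs : IsAdmissible s) : ((mzvE s).toReal : ℂ) = mzv s := by
  rw [mzvE, (tsum_mterm_recip zero_lt_one hs).2, mzv_eq_hurwitzMzv, Complex.ofReal_zero]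

theorem momentE_nil (n : ℕ) : momentE [] n = ENNReal.ofReal (1 / n) := by
  rw [momentE, tsum_eq_single 0]
  · simp [mterm]
  · intro m hm
    simp [mterm, hm]

theorem momentE_zero {k : List ℕ} (hk : k ≠ []) : momentE k 0 = mzvE (addHead k) := by
  obtain ⟨a, t, rfl⟩ := List.exists_cons_of_ne_nil hk
  refine tsum_congr fun N => ?_
  rw [addHead, mterm_succ_cons, mul_comm, recip]
  simp

/-- Partial fractions: `n / (N (n + N)) + 1 / (n + N) = 1 / N`. -/
theorem mul_momentE_succ (a : ℕ) (t : List ℕ) (n : ℕ) :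
    ENNReal.ofReal n * momentE ((a + 1) :: t) n + momentE (a :: t) n = mzvE ((a + 1) :: t) := by
  rw [momentE, momentE, mzvE, ← ENNReal.tsum_mul_left, ← ENNReal.tsum_add]
  refine tsum_congr fun N => ?_
  rcases Nat.eq_zero_or_pos N with rfl | hN
  · simp [mterm_cons_zero]
  have h : ENNReal.ofReal n * recip 0 N * ENNReal.ofReal (1 / ((n : ℝ) + N))
      + ENNReal.ofReal (1 / ((n : ℝ) + N)) = recip 0 N := by
    have hN0 : (0 : ℝ) < N := by exact_mod_cast hN
    rw [recip, sub_zero, ← ENNReal.ofReal_mul (by positivity),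
      ← ENNReal.ofReal_mul (by positivity), ← ENNReal.ofReal_add (by positivity) (by positivity)]
    congr 1
    field_simp
  rw [mterm_succ_cons]
  conv_rhs => rw [← h]
  ring

theorem hasSum_inv_sub_inv (n i : ℕ) :
    HasSum (fun N : ℕ => (n : ℝ) * (1 / ((N + (i + 1) : ℕ) : ℝ))
      * (1 / ((n : ℝ) + (N + (i + 1) : ℕ)))) (∑ j ∈ Finset.Icc 1 n, 1 / ((j : ℝ) + i)) := by
  induction n with
  | zero => simp
  | succ n ih =>
    have h : HasSum (fun N : ℕ => 1 / ((N : ℝ) + n + i + 1) - 1 / ((N : ℝ) + n + i + 2))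
        (1 / ((n + 1 : ℕ) + (i : ℝ))) := by
      rw [hasSum_iff_tendsto_nat_of_nonneg]
      · have h1 : ∀ M : ℕ, ∑ N ∈ Finset.range M,
            (1 / ((N : ℝ) + n + i + 1) - 1 / ((N : ℝ) + n + i + 2))
            = 1 / ((n + 1 : ℕ) + (i : ℝ)) - 1 / ((M : ℝ) + (n + i + 1)) := by
          intro M
          induction M with
          | zero => push_cast; ring
          | succ M ihM => rw [Finset.sum_range_succ, ihM]; push_cast; ring
        simp only [h1]
        have h2 : Tendsto (fun M : ℕ => 1 / ((M : ℝ) + (n + i + 1))) atTop (𝓝 0) :=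
          tendsto_const_nhds.div_atTop
            (tendsto_atTop_add_const_right _ _ tendsto_natCast_atTop_atTop)
        simpa using h2.const_sub (1 / ((n + 1 : ℕ) + (i : ℝ)))
      · intro N
        rw [sub_nonneg]
        gcongr
        norm_num
    rw [Finset.sum_Icc_succ_top (by omega)]
    convert ih.add h using 1
    ext N
    push_cast
    field_simp
    ring

/-- For a leading `1`, the sum of `n / (N (n + N)) = 1 / N - 1 / (n + N)` over `N > i` is `∑_{j ≤ n}
1 / (j + i)`. The weak inequality `j ≤ n` is the source of the star sums. -/
theorem mul_momentE_one (t : List ℕ) (n : ℕ) :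
    ENNReal.ofReal n * momentE (1 :: t) n = ∑ j ∈ Finset.Icc 1 n, momentE t j := by
  have h1 : ENNReal.ofReal n * momentE (1 :: t) n
      = ∑' N, (∑ i ∈ Finset.range N, mterm (recip 0) t i)
          * ENNReal.ofReal ((n : ℝ) * (1 / (N : ℝ)) * (1 / ((n : ℝ) + N))) := by
    rw [momentE, ← ENNReal.tsum_mul_left]
    refine tsum_congr fun N => ?_
    rw [ENNReal.ofReal_mul (by positivity), ENNReal.ofReal_mul (by positivity), mterm, recip,
      pow_one, sub_zero]
    ring
  have h2 : ∀ i : ℕ, ∑' N : ℕ, (if i < N then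
      ENNReal.ofReal ((n : ℝ) * (1 / (N : ℝ)) * (1 / ((n : ℝ) + N))) else 0)
      = ∑ j ∈ Finset.Icc 1 n, ENNReal.ofReal (1 / ((j : ℝ) + i)) := fun i => by
    rw [tsum_ite_lt_ofReal (f := fun N : ℕ => (n : ℝ) * (1 / (N : ℝ)) * (1 / ((n : ℝ) + N)))
      (hasSum_inv_sub_inv n i) fun N => by positivity,
      ENNReal.ofReal_sum_of_nonneg fun j _ => by positivity]
  rw [h1, ← tsum_mul_tsum_ite_lt]
  simp only [h2, Finset.mul_sum, momentE]
  exact Summable.tsum_finsetSum fun _ _ => ENNReal.summable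

theorem momentE_cons_ne_top {a : ℕ} {t : List ℕ} (ha : 0 < a) (ht : ∀ b ∈ t, 0 < b) (n : ℕ) :
    momentE (a :: t) n ≠ ⊤ := by
  have h : mzvE ((a + 1) :: t) ≠ ⊤ :=
    mzvE_ne_top ⟨by simpa using ht, by simp; omega⟩
  rw [← mul_momentE_succ a t n] at h
  exact (ENNReal.add_ne_top.1 h).2

theorem momentE_ne_top {k : List ℕ} (hk : ∀ b ∈ k, 0 < b) (n : ℕ) : momentE k n ≠ ⊤ := by
  cases k with
  | nil => rw [momentE_nil]; exact ENNReal.ofReal_ne_top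
  | cons a t => exact momentE_cons_ne_top (hk a (by simp)) (fun b hb => hk b (by simp [hb])) n

/-- The moment `∑_{N > n₂ > ⋯} 1 / (N^{k₁} n₂^{k₂} ⋯) · 1 / (n + N)` as a real number. -/
noncomputable def moment (k : List ℕ) (n : ℕ) : ℝ := (momentE k n).toReal

theorem moment_nonneg (k : List ℕ) (n : ℕ) : 0 ≤ moment k n := ENNReal.toReal_nonneg

theorem mul_moment_one {t : List ℕ} (ht : ∀ b ∈ t, 0 < b) (n : ℕ) :
    n * moment (1 :: t) n = ∑ j ∈ Finset.Icc 1 n, moment t j := by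
  have h := congrArg ENNReal.toReal (mul_momentE_one t n)
  rw [ENNReal.toReal_mul, ENNReal.toReal_ofReal (by positivity),
    ENNReal.toReal_sum fun j _ => momentE_ne_top ht j] at h
  exact h

theorem mul_moment_succ {a : ℕ} {t : List ℕ} (ha : 0 < a) (ht : ∀ b ∈ t, 0 < b) (n : ℕ) :
    n * moment ((a + 1) :: t) n + moment (a :: t) n = (mzvE ((a + 1) :: t)).toReal := by
  have h := congrArg ENNReal.toReal (mul_momentE_succ a t n)
  rw [ENNReal.toReal_add (ENNReal.mul_ne_top ENNReal.ofReal_ne_top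
    (momentE_cons_ne_top (by omega) ht n)) (momentE_cons_ne_top ha ht n), ENNReal.toReal_mul,
    ENNReal.toReal_ofReal (by positivity)] at h
  exact h

/-- For a leading part at least `2`, `n` times the moment is bounded by a zeta value; a leading `1`
costs one logarithm. -/
theorem exists_moment_le (k : List ℕ) (hk : ∀ b ∈ k, 0 < b) :
    ∃ C : ℝ, 0 ≤ C ∧ ∀ n : ℕ, 1 ≤ n → moment k n ≤ C * (logBound n ^ k.length / n) := by
  induction k with
  | nil =>
    refine ⟨1, zero_le_one, fun n _ => ?_⟩
    rw [moment, momentE_nil, ENNReal.toReal_ofReal (by positivity)]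
    simp
  | cons a t ih =>
    have ht : ∀ b ∈ t, 0 < b := fun b hb => hk b (by simp [hb])
    have ha : 0 < a := hk a (by simp)
    obtain ⟨C, hC0, hC⟩ := ih ht
    rcases Nat.lt_or_ge 1 a with h1 | h1
    · obtain ⟨a, rfl⟩ : ∃ b, a = b + 1 := ⟨a - 1, by omega⟩
      refine ⟨(mzvE ((a + 1) :: t)).toReal, ENNReal.toReal_nonneg, fun n hn => ?_⟩
      have hn0 : (0 : ℝ) < n := by exact_mod_cast hn
      have h2 := mul_moment_succ (by omega : 0 < a) ht n
      have h3 := moment_nonneg (a :: t) n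
      have h4 : (mzvE ((a + 1) :: t)).toReal
          ≤ (mzvE ((a + 1) :: t)).toReal * logBound n ^ ((a + 1) :: t).length :=
        le_mul_of_one_le_right ENNReal.toReal_nonneg (one_le_pow₀ (one_le_logBound n))
      rw [mul_div_assoc', le_div_iff₀ hn0]
      linarith
    · obtain rfl : a = 1 := by omega
      refine ⟨C, hC0, fun n hn => ?_⟩
      have hn0 : (0 : ℝ) < n := by exact_mod_cast hn
      rw [mul_div_assoc', le_div_iff₀ hn0, mul_comm, mul_moment_one ht]
      calc ∑ j ∈ Finset.Icc 1 n, moment t j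
          ≤ ∑ j ∈ Finset.Icc 1 n, C * (logBound j ^ t.length / j) :=
            Finset.sum_le_sum fun j hj => hC j (Finset.mem_Icc.1 hj).1
        _ ≤ C * logBound n ^ (t.length + 1) := by
            rw [← Finset.mul_sum]
            gcongr
            exact sum_logBound_pow_div_le _ _
        _ = _ := by simp

/-- The partial fraction step is iterated `a - 1` times with alternating signs, after which the
leading part is `1` and can be removed. -/
theorem moment_cons_eq {a : ℕ} {t : List ℕ} (ha : 0 < a) (ht : ∀ b ∈ t, 0 < b) {n : ℕ}
    (hn : 1 ≤ n) :
    (moment (a :: t) n : ℂ)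
      = ∑ j ∈ Finset.Icc 1 (a - 1), (-1 : ℂ) ^ (j - 1) * mzv ((a + 1 - j) :: t) * (1 / (n : ℂ) ^ j)
        + (-1) ^ (a - 1) * (1 / (n : ℂ) ^ a * ∑ i ∈ Finset.Icc 1 n, (moment t i : ℂ)) := by
  have hn0 : (n : ℂ) ≠ 0 := by exact_mod_cast (by omega : n ≠ 0)
  obtain ⟨a, rfl⟩ : ∃ b, a = b + 1 := ⟨a - 1, by omega⟩
  clear ha
  induction a with
  | zero =>
    have h := congrArg (fun r : ℝ => (r : ℂ)) (mul_moment_one ht n)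
    push_cast at h
    rw [zero_add, ← h]
    simp [hn0]
  | succ a ih =>
    have h := congrArg (fun r : ℝ => (r : ℂ)) (mul_moment_succ (Nat.succ_pos a) ht n)
    simp only [Complex.ofReal_add, Complex.ofReal_mul, Complex.ofReal_natCast] at h
    rw [toReal_mzvE ⟨by simpa using ht, by simp⟩] at h
    have h1 : (moment ((a + 1 + 1) :: t) n : ℂ)
        = 1 / n * (mzv ((a + 1 + 1) :: t) - moment ((a + 1) :: t) n) := by
      rw [← h]; field_simp; simp
    rw [h1, ih]
    simp only [Nat.add_sub_cancel]
    rw [← Finset.add_sum_Ioc_eq_sum_Icc (by omega : 1 ≤ a + 1)]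
    have h2 : ∑ j ∈ Finset.Ioc 1 (a + 1),
        (-1 : ℂ) ^ (j - 1) * mzv ((a + 1 + 1 + 1 - j) :: t) * (1 / (n : ℂ) ^ j)
        = - (1 / n * ∑ j ∈ Finset.Icc 1 a,
            (-1 : ℂ) ^ (j - 1) * mzv ((a + 1 + 1 - j) :: t) * (1 / (n : ℂ) ^ j)) := by
      rw [Finset.mul_sum, ← Finset.sum_neg_distrib]
      symm
      refine Finset.sum_nbij (· + 1) ?_ ?_ ?_ ?_
      · intro j hj; simp at hj ⊢; omega
      · intro i _ j _ h; simpa using h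
      · intro j hj
        simp at hj
        exact ⟨j - 1, by simp; omega, by simp; omega⟩
      · intro j hj
        obtain ⟨i, rfl⟩ : ∃ i, j = i + 1 := ⟨j - 1, by simp at hj; omega⟩
        rw [show a + 1 + 1 + 1 - (i + 1 + 1) = a + 1 + 1 - (i + 1) by omega]
        simp only [Nat.add_sub_cancel, pow_succ]
        field_simp
    rw [h2]
    simp only [pow_succ, Nat.sub_self, pow_zero]
    rw [show a + 1 + 1 + 1 - 1 = a + 1 + 1 by omega]
    field_simp
    ring

/-- Ensures that the sign exponents `|·| - l` involve no truncated subtraction. -/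
theorem length_take_le_sum {t : List ℕ} (ht : ∀ b ∈ t, 0 < b) {l : ℕ} (hl : l ≤ t.length) :
    l ≤ (t.take l).sum := by
  induction t generalizing l with
  | nil => simp at hl; omega
  | cons b t ih =>
    cases l with
    | zero => simp
    | succ l =>
      have h1 := ih (fun c hc => ht c (by simp [hc])) (l := l) (by simpa using hl)
      have h2 := ht b (by simp)
      simp
      omega

theorem sum_moment_eq (t : List ℕ) (ht : ∀ b ∈ t, 0 < b) (n : ℕ) :
    ∑ i ∈ Finset.Icc 1 n, (moment t i : ℂ)
      = ∑ l ∈ Finset.range (t.length + 1), (-1 : ℂ) ^ ((t.take l).sum - l)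
          * ∑ j ∈ Finset.Icc 1 ((t ++ [2]).getD l 0 - 1),
            (-1 : ℂ) ^ (j - 1)
              * mzv (if l = t.length then [] else ((t ++ [2]).getD l 0 + 1 - j) :: t.drop (l + 1))
              * mhsStar n (t.take l ++ [j]) := by
  induction t generalizing n with
  | nil =>
    -- For the empty index the moment at `i` is `1 / i`, so the sum is `ζ⋆_n(1)`; the appended part
    -- `2` leaves only `j = 1`.
    have h : mzv [] = 1 := by
      simp [mzv, mhs, tendsto_const_nhds.limUnder_eq]
    simp [mhsStar, h, moment, momentE_nil]
  | cons b t ih =>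
    have ht' : ∀ c ∈ t, 0 < c := fun c hc => ht c (by simp [hc])
    have hb : 0 < b := ht b (by simp)
    -- The term `l = 0` is the zeta value part of `moment_cons_eq`; the terms `l + 1` come from the
    -- induction hypothesis for `t`.
    rw [List.length_cons, Finset.sum_range_succ', Finset.sum_congr rfl fun i hi =>
      moment_cons_eq hb ht' (Finset.mem_Icc.1 hi).1, Finset.sum_add_distrib, add_comm]
    congr 1
    · rw [← Finset.mul_sum]
      simp only [ih ht', Finset.mul_sum]
      rw [Finset.sum_comm]
      refine Finset.sum_congr rfl fun l hl => ?_
      have hl' := length_take_le_sum ht' (l := l) (by simp at hl; omega)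
      have e : ((b :: t).take (l + 1)).sum - (l + 1) = (b - 1) + ((t.take l).sum - l) := by
        simp; omega
      rw [e, pow_add, Finset.sum_comm]
      refine Finset.sum_congr (by simp) fun j _ => ?_
      simp only [List.take_succ_cons, List.cons_append, mhsStar, Finset.mul_sum]
      refine Finset.sum_congr rfl fun i _ => ?_
      simp
      ring
    · rw [Finset.sum_comm]
      simp [mhsStar, Finset.mul_sum]

theorem moment_eq {k : List ℕ} (hk : IsComposition k) {n : ℕ} (hn : 1 ≤ n) :
    (moment k n : ℂ)
      = ∑ j ∈ Finset.Icc 1 (part k 1 - 1),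
          (-1 : ℂ) ^ (j - 1) * mzv ((part k 1 + 1 - j) :: seg k 2 k.length) * (1 / (n : ℂ) ^ j)
        + ∑ l ∈ Finset.Icc 1 k.length, (-1 : ℂ) ^ ((seg k 1 l).sum - l)
            * ∑ j ∈ Finset.Icc 1 (part k (l + 1) - 1),
                (-1 : ℂ) ^ (j - 1) * mzv (tailIndex k l j)
                  * (mhsStar n (seg k 2 l ++ [j]) / (n : ℂ) ^ part k 1) := by
  obtain ⟨hne, hpos⟩ := hk
  obtain ⟨a, t, rfl⟩ := List.exists_cons_of_ne_nil hne
  have ht : ∀ c ∈ t, 0 < c := fun c hc => hpos c (by simp [hc])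
  have ha : 0 < a := hpos a (by simp)
  rw [moment_cons_eq ha ht hn]
  have h1 : part (a :: t) 1 = a := rfl
  have h2 : seg (a :: t) 2 (a :: t).length = t := by simp [seg]
  rw [h1, h2, sum_moment_eq t ht]
  congr 1
  have hset : Finset.Icc 1 (a :: t).length = Finset.Ico (0 + 1) (t.length + 1 + 1) := by
    ext; simp
  rw [hset, ← Finset.sum_Ico_add', ← Finset.range_eq_Ico, Finset.mul_sum, Finset.mul_sum]
  refine Finset.sum_congr rfl fun l hl => ?_
  have hl' := length_take_le_sum ht (l := l) (by simp at hl; omega)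
  have e : (seg (a :: t) 1 (l + 1)).sum - (l + 1) = (a - 1) + ((t.take l).sum - l) := by
    simp [seg]; omega
  have h3 : part (a :: t) (l + 1 + 1) = (t ++ [2]).getD l 0 := by simp [part]
  have h4 : seg (a :: t) 2 (l + 1) = t.take l := by simp [seg]
  rw [e, h3, h4, pow_add]
  simp only [Finset.mul_sum]
  refine Finset.sum_congr rfl fun j _ => ?_
  have h5 : tailIndex (a :: t) (l + 1) j
      = if l = t.length then [] else ((t ++ [2]).getD l 0 + 1 - j) :: t.drop (l + 1) := by
    simp [tailIndex, part, seg]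
  rw [h5]
  ring

/-! ### Analytic continuation to the half plane -/

/-- A bounded piece of a half plane `Re z < 1 - δ`. -/
def halfDisc (δ R : ℝ) : Set ℂ := {z | z.re < 1 - δ} ∩ Metric.ball 0 R

theorem isOpen_halfDisc (δ R : ℝ) : IsOpen (halfDisc δ R) :=
  (isOpen_lt Complex.continuous_re continuous_const).inter Metric.isOpen_ball

theorem isPreconnected_halfDisc (δ R : ℝ) : IsPreconnected (halfDisc δ R) :=
  ((convex_halfSpace_re_lt (1 - δ)).inter (convex_ball 0 R)).isPreconnected

/-- Expanding around `1`, `|z+i|² ≤ (i+1)² - 2δ(i+1) + (R+1)²`. With `1 + y ≤ exp y`, half of this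
correction enters the exponent of each factor; the harmonic sum yields `n ^ (-δ)` and the sum of
inverse squares a constant. -/
theorem exists_norm_risingQuot_le {δ : ℝ} (hδ : 0 < δ) (R : ℝ) :
    ∃ C : ℝ, 0 ≤ C ∧ ∀ z ∈ halfDisc δ R, ∀ n : ℕ, 1 ≤ n →
      ‖risingQuot z n‖ ≤ C * (n : ℝ) ^ (-δ) := by
  have hT : Summable fun i : ℕ => (1 : ℝ) / ((i : ℝ) + 1) ^ 2 := by
    have h := (summable_nat_add_iff 1).2 (Real.summable_one_div_nat_pow.2 one_lt_two)
    simpa using h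
  set T := ∑' i : ℕ, (1 : ℝ) / ((i : ℝ) + 1) ^ 2 with hTdef
  set Q := (R + 1) ^ 2 / 2 with hQ
  have hQ0 : 0 ≤ Q := by positivity
  refine ⟨Real.exp (Q * T), (Real.exp_pos _).le, fun z hz n hn => ?_⟩
  have hz1 : z.re < 1 - δ := hz.1
  have hz2 : ‖z‖ < R := by simpa using hz.2
  have hfac : ∀ i : ℕ, ‖(z + i) / ((i : ℂ) + 1)‖
      ≤ Real.exp (-δ * (1 / ((i : ℝ) + 1)) + Q * (1 / ((i : ℝ) + 1) ^ 2)) := by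
    intro i
    have hi : (0 : ℝ) < (i : ℝ) + 1 := by positivity
    refine abs_le_of_sq_le_sq' ?_ (Real.exp_pos _).le |>.2
    rw [← Real.exp_nat_mul]
    refine le_trans ?_ (Real.add_one_le_exp _)
    have hn1 : ‖(i : ℂ) + 1‖ = (i : ℝ) + 1 := by
      have : ((i : ℂ) + 1) = ((i + 1 : ℝ) : ℂ) := by push_cast; rfl
      rw [this, Complex.norm_real, Real.norm_of_nonneg hi.le]
    have hn2 : ‖z + i‖ ^ 2 ≤ (i + 1) ^ 2 - 2 * δ * (i + 1) + (R + 1) ^ 2 := by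
      have h1 : ‖z - 1‖ ≤ R + 1 := (norm_sub_le _ _).trans (by simp; linarith)
      have h2 : ‖z + i‖ ^ 2 = (i + 1) ^ 2 + 2 * (z.re - 1) * (i + 1) + ‖z - 1‖ ^ 2 := by
        rw [← Complex.normSq_eq_norm_sq, ← Complex.normSq_eq_norm_sq, Complex.normSq_apply,
          Complex.normSq_apply]
        simp
        ring
      have h3 : ‖z - 1‖ ^ 2 ≤ (R + 1) ^ 2 := by gcongr
      rw [h2]
      nlinarith
    rw [norm_div, hn1, div_pow, div_le_iff₀ (by positivity)]
    refine hn2.trans (le_of_eq ?_)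
    rw [hQ]
    push_cast
    field_simp
    ring
  have hH : Real.log n ≤ ∑ i ∈ Finset.range n, 1 / ((i : ℝ) + 1) := by
    have h1 := log_add_one_le_harmonic n
    have h2 : ((harmonic n : ℚ) : ℝ) = ∑ i ∈ Finset.range n, 1 / ((i : ℝ) + 1) := by
      simp [harmonic]
    rw [← h2]
    refine le_trans (Real.log_le_log (by exact_mod_cast hn) ?_) h1
    push_cast
    linarith
  calc ‖risingQuot z n‖ = ∏ i ∈ Finset.range n, ‖(z + i) / ((i : ℂ) + 1)‖ := norm_prod _ _
    _ ≤ ∏ i ∈ Finset.range n,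
        Real.exp (-δ * (1 / ((i : ℝ) + 1)) + Q * (1 / ((i : ℝ) + 1) ^ 2)) :=
      Finset.prod_le_prod (fun _ _ => norm_nonneg _) fun i _ => hfac i
    _ = Real.exp (-δ * ∑ i ∈ Finset.range n, 1 / ((i : ℝ) + 1)
          + Q * ∑ i ∈ Finset.range n, 1 / ((i : ℝ) + 1) ^ 2) := by
      rw [← Real.exp_sum, Finset.sum_add_distrib, Finset.mul_sum, Finset.mul_sum]
    _ ≤ Real.exp (-δ * Real.log n + Q * T) := by
      refine Real.exp_le_exp.2 (add_le_add ?_ ?_)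
      · exact mul_le_mul_of_nonpos_left hH (by linarith)
      · exact mul_le_mul_of_nonneg_left (hT.sum_le_tsum _ fun i _ => by positivity) hQ0
    _ = Real.exp (Q * T) * (n : ℝ) ^ (-δ) := by
      rw [Real.exp_add, mul_comm, Real.rpow_def_of_pos (by exact_mod_cast hn), mul_comm (-δ)]

/-- The partial sums of `∑ₙ binom(z + n - 1, n) · moment k n`. -/
noncomputable def momentSeries (k : List ℕ) (N : ℕ) (z : ℂ) : ℂ :=
  (moment k 0 : ℂ) + ∑ n ∈ Finset.range N, risingQuot z (n + 1) * (moment k (n + 1) : ℂ)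

/-- The partial sums of `ζ(s; 1 - z)`. -/
noncomputable def hurwitzSeries (s : List ℕ) (N : ℕ) (z : ℂ) : ℂ :=
  ∑ m ∈ Finset.range N, mterm (fun m : ℕ => 1 / ((m : ℂ) + (1 - z) - 1)) s m

theorem exists_norm_risingQuot_mul_moment_le {k : List ℕ} (hk : ∀ b ∈ k, 0 < b) {δ : ℝ}
    (hδ : 0 < δ) (R : ℝ) :
    ∃ u : ℕ → ℝ, Summable u ∧ ∀ n, ∀ z ∈ halfDisc δ R,
      ‖risingQuot z (n + 1) * (moment k (n + 1) : ℂ)‖ ≤ u n := by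
  obtain ⟨C, hC0, hC⟩ := exists_norm_risingQuot_le hδ R
  obtain ⟨B, hB0, hB⟩ := exists_moment_le k hk
  refine ⟨fun n => C * B * (((n + 1 : ℕ) : ℝ) ^ (-1 - δ) * logBound (n + 1) ^ k.length), ?_, ?_⟩
  · exact ((summable_nat_add_iff 1).2
      (summable_rpow_mul_logBound_pow k.length (by linarith : -1 - δ < -1))).mul_left _
  · intro n z hz
    have hn : (0 : ℝ) < (n + 1 : ℕ) := by positivity
    rw [norm_mul, Complex.norm_real, Real.norm_of_nonneg (moment_nonneg _ _)]
    calc ‖risingQuot z (n + 1)‖ * moment k (n + 1)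
        ≤ C * ((n + 1 : ℕ) : ℝ) ^ (-δ) * (B * (logBound (n + 1) ^ k.length / (n + 1 : ℕ))) :=
          mul_le_mul (hC z hz _ (by omega)) (hB _ (by omega)) (moment_nonneg _ _) (by positivity)
      _ = _ := by
          have h := Real.rpow_sub_one hn.ne' (-δ)
          simp only [show -1 - δ = -δ - 1 by ring, h]
          ring

theorem tendstoUniformlyOn_momentSeries {k : List ℕ} (hk : ∀ b ∈ k, 0 < b) {δ : ℝ} (hδ : 0 < δ)
    (R : ℝ) :
    TendstoUniformlyOn (momentSeries k)
      (fun z => (moment k 0 : ℂ) + ∑' n, risingQuot z (n + 1) * (moment k (n + 1) : ℂ)) atTop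
      (halfDisc δ R) := by
  obtain ⟨u, hu, hle⟩ := exists_norm_risingQuot_mul_moment_le hk hδ R
  have h := tendstoUniformlyOn_tsum_nat hu hle
  have hc : TendstoUniformlyOn (fun (_ : ℕ) (_ : ℂ) => (moment k 0 : ℂ))
      (fun _ => (moment k 0 : ℂ)) atTop (halfDisc δ R) := by
    intro v hv
    exact Eventually.of_forall fun _ _ _ => refl_mem_uniformity hv
  exact hc.add h

theorem tendstoUniformlyOn_hurwitzSeries {s : List ℕ} (hs : IsAdmissible s) (hne : s ≠ []) {δ : ℝ}
    (hδ : 0 < δ) (hδ1 : δ ≤ 1) (R : ℝ) :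
    TendstoUniformlyOn (hurwitzSeries s) (fun z => hurwitzMzv (1 - z) s) atTop
      (halfDisc δ R) := by
  obtain ⟨a, t, rfl⟩ := List.exists_cons_of_ne_nil hne
  have ha : 2 ≤ a := hs.2 a (by simp)
  have h := tendstoUniformlyOn_tsum_nat (s := halfDisc δ R)
    (summable_norm_mterm_bound ha (δ⁻¹ ^ (a + t.sum)) t.length) fun m z hz =>
      norm_mterm_cons_le' (inv_nonneg.2 hδ.le) (fun m hm => norm_hcoef_le hδ hδ1 (le_of_lt hz.1) hm)
        (by omega) t (fun b hb => hs.1 b (by simp [hb])) m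
  refine h.congr_right fun z hz => ?_
  have hz1 : z.re < 1 - δ := hz.1
  exact (hasSum_hurwitz_of_re_lt (by linarith) hs).1.tsum_eq

theorem differentiable_risingQuot (n : ℕ) : Differentiable ℂ fun z : ℂ => risingQuot z n := by
  unfold risingQuot
  fun_prop

theorem differentiable_momentSeries (k : List ℕ) (N : ℕ) : Differentiable ℂ (momentSeries k N) := by
  unfold momentSeries
  have := differentiable_risingQuot
  fun_prop

theorem hcoef_ne_zero {z : ℂ} (hz : z.re < 1) {m : ℕ} (hm : 1 ≤ m) :
    (m : ℂ) + (1 - z) - 1 ≠ 0 := by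
  intro h
  have h1 := congrArg Complex.re h
  have hm1 : (1 : ℝ) ≤ m := by exact_mod_cast hm
  simp at h1
  linarith

theorem analyticAt_mterm {z : ℂ} (hz : z.re < 1) (s : List ℕ) (m : ℕ) :
    AnalyticAt ℂ (fun z : ℂ => mterm (fun m : ℕ => 1 / ((m : ℂ) + (1 - z) - 1)) s m) z := by
  induction s generalizing m with
  | nil => exact analyticAt_const
  | cons a t ih =>
    rcases Nat.eq_zero_or_pos m with rfl | hm
    · simp only [mterm_cons_zero]
      exact analyticAt_const
    · simp only [mterm]
      have h : AnalyticAt ℂ (fun z : ℂ => (m : ℂ) + (1 - z) - 1) z := by fun_prop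
      refine AnalyticAt.mul (AnalyticAt.pow (AnalyticAt.div analyticAt_const h
        (hcoef_ne_zero hz hm)) a) ?_
      exact Finset.analyticAt_fun_sum _ fun i _ => ih i

theorem analyticAt_hurwitzSeries {z : ℂ} (hz : z.re < 1) (s : List ℕ) (N : ℕ) :
    AnalyticAt ℂ (hurwitzSeries s N) z :=
  Finset.analyticAt_fun_sum _ fun i _ => analyticAt_mterm hz s i

theorem isAdmissible_addHead_hoffmanDual {k : List ℕ} (hk : IsComposition k) :
    IsAdmissible (addHead (hoffmanDual k)) ∧ addHead (hoffmanDual k) ≠ [] := by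
  obtain ⟨⟨h1, h2⟩, -⟩ := hoffmanDual_spec k hk
  cases h : hoffmanDual k with
  | nil => exact absurd h h1
  | cons a t =>
    rw [h] at h2
    have ha := h2 a (by simp)
    refine ⟨⟨fun m hm => ?_, by simp [addHead]; omega⟩, by simp [addHead]⟩
    rcases List.mem_cons.1 hm with rfl | hm
    · omega
    · exact h2 m (by simp [hm])

theorem IsComposition.reverse {k : List ℕ} (hk : IsComposition k) : IsComposition k.reverse :=
  ⟨by simpa using hk.1, by simpa using hk.2⟩

theorem moment_series_eq_hurwitzMzv_of_real {k : List ℕ} (hk : IsComposition k) {x : ℝ}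
    (hx0 : 0 < x) (hx : x < 1) :
    (moment k 0 : ℂ) + ∑' n, risingQuot (x : ℂ) (n + 1) * (moment k (n + 1) : ℂ)
      = hurwitzMzv (1 - x) (addHead (hoffmanDual k.reverse)) := by
  have hadm := isAdmissible_addHead_hoffmanDual hk.reverse
  have h1 := tsum_mterm_recip hx hadm.1
  rw [← h1.2, ← tsum_risingQuot_mul_momentE hx0 hx hk]
  have h2 := h1.1
  rw [← tsum_risingQuot_mul_momentE hx0 hx hk] at h2
  have h3 : ∀ n, (ENNReal.ofReal (risingQuot x n) * momentE k n).toReal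
      = risingQuot x n * moment k n := fun n => by
    rw [ENNReal.toReal_mul, ENNReal.toReal_ofReal (risingQuot_nonneg hx0 n), moment]
  have h4 : Summable fun n => risingQuot x n * moment k n := by
    simpa only [h3] using ENNReal.summable_toReal h2
  rw [ENNReal.tsum_toReal_eq fun n => ENNReal.ne_top_of_tsum_ne_top h2 n]
  simp only [h3]
  rw [h4.tsum_eq_zero_add, Complex.ofReal_add, Complex.ofReal_tsum]
  simp [risingQuot]

/-- Identity theorem at `1/2`, an accumulation point of the real interval where equality is known;
the bounds on `δ` and `R` put it inside the region. -/
theorem moment_series_eq_hurwitzMzv {k : List ℕ} (hk : IsComposition k) {δ R : ℝ} (hδ : 0 < δ)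
    (hδ1 : δ < 1 / 2) (hR : 1 / 2 < R) :
    Set.EqOn (fun z => (moment k 0 : ℂ) + ∑' n, risingQuot z (n + 1) * (moment k (n + 1) : ℂ))
      (fun z => hurwitzMzv (1 - z) (addHead (hoffmanDual k.reverse))) (halfDisc δ R) := by
  have hadm := isAdmissible_addHead_hoffmanDual hk.reverse
  have hU := isOpen_halfDisc δ R
  have hf := ((tendstoUniformlyOn_momentSeries hk.2 hδ R).tendstoLocallyUniformlyOn.differentiableOn
    (Eventually.of_forall fun N => (differentiable_momentSeries k N).differentiableOn)
    hU).analyticOnNhd hU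
  have hg := ((tendstoUniformlyOn_hurwitzSeries hadm.1 hadm.2 hδ (by linarith)
    R).tendstoLocallyUniformlyOn.differentiableOn
    (Eventually.of_forall fun N z hz => (analyticAt_hurwitzSeries
      (by have : z.re < 1 - δ := hz.1; linarith) _ N).differentiableAt.differentiableWithinAt)
    hU).analyticOnNhd hU
  refine hf.eqOn_of_preconnected_of_frequently_eq hg (isPreconnected_halfDisc δ R)
    (z₀ := ((1 / 2 : ℝ) : ℂ)) ⟨?_, ?_⟩ ?_
  · show (((1 / 2 : ℝ) : ℂ)).re < 1 - δ
    rw [Complex.ofReal_re]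
    linarith
  · rw [mem_ball_zero_iff, Complex.norm_real, Real.norm_of_nonneg (by norm_num)]
    exact hR
  · have h1 : ∃ᶠ x : ℝ in 𝓝[≠] (1 / 2 : ℝ), 0 < x ∧ x < 1 := by
      refine Eventually.frequently (eventually_nhdsWithin_of_eventually_nhds ?_)
      exact (lt_mem_nhds (by norm_num)).and (gt_mem_nhds (by norm_num))
    have h2 : Tendsto (fun x : ℝ => (x : ℂ)) (𝓝[≠] (1 / 2 : ℝ)) (𝓝[≠] ((1 / 2 : ℝ) : ℂ)) :=
      Complex.continuous_ofReal.continuousAt.continuousWithinAt.tendsto_nhdsWithin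
        fun x hx => Complex.ofReal_injective.ne hx
    exact h2.frequently (h1.mono fun x hx => moment_series_eq_hurwitzMzv_of_real hk hx.1 hx.2)

/-- Weierstrass's theorem, iterated. -/
theorem tendstoLocallyUniformlyOn_iteratedDeriv {U : Set ℂ} (hU : IsOpen U) {F : ℕ → ℂ → ℂ}
    {f : ℂ → ℂ} (hF : ∀ N, DifferentiableOn ℂ (F N) U) (h : TendstoLocallyUniformlyOn F f atTop U)
    (q : ℕ) :
    TendstoLocallyUniformlyOn (fun N => iteratedDeriv q (F N)) (iteratedDeriv q f) atTop U ∧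
      ∀ N, DifferentiableOn ℂ (iteratedDeriv q (F N)) U := by
  induction q with
  | zero => simpa using ⟨h, hF⟩
  | succ q ih =>
    simp only [iteratedDeriv_succ]
    exact ⟨ih.1.deriv (Eventually.of_forall ih.2) hU, fun N => (ih.2 N).deriv hU⟩

/-- Both sequences of partial sums converge locally uniformly to one function near `α`, so their
derivatives there share a limit. -/
theorem eq_iteratedDeriv_limits {k : List ℕ} (hk : IsComposition k) {α : ℂ} (hα : α.re < 1)
    (q : ℕ) :
    ∃ L : ℂ, Tendsto (fun N => iteratedDeriv q (momentSeries k N) α) atTop (𝓝 L) ∧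
      Tendsto (fun N => iteratedDeriv q
        (hurwitzSeries (addHead (hoffmanDual k.reverse)) N) α) atTop (𝓝 L) := by
  obtain ⟨δ, hδ, hδ'⟩ := exists_between (show 0 < min (1 / 2) (1 - α.re) by
    exact lt_min (by norm_num) (by linarith))
  have hδ1 : δ < 1 / 2 := hδ'.trans_le (min_le_left _ _)
  have hδ2 : δ < 1 - α.re := hδ'.trans_le (min_le_right _ _)
  set R := ‖α‖ + 1
  have hR : 1 / 2 < R := by have := norm_nonneg α; simp only [R]; linarith
  have hU := isOpen_halfDisc δ R
  have hmem : α ∈ halfDisc δ R :=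
    ⟨by show α.re < 1 - δ; linarith, by simp [R]⟩
  have hadm := isAdmissible_addHead_hoffmanDual hk.reverse
  have h1 := (tendstoLocallyUniformlyOn_iteratedDeriv hU
    (fun N => (differentiable_momentSeries k N).differentiableOn)
    (tendstoUniformlyOn_momentSeries hk.2 hδ R).tendstoLocallyUniformlyOn q).1
  have h2 := (tendstoLocallyUniformlyOn_iteratedDeriv hU
    (fun N z hz => (analyticAt_hurwitzSeries
      (by have : z.re < 1 - δ := hz.1; linarith) _ N).differentiableAt.differentiableWithinAt)
    ((tendstoUniformlyOn_hurwitzSeries hadm.1 hadm.2 hδ (by linarith)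
      R).tendstoLocallyUniformlyOn.congr_right
        (moment_series_eq_hurwitzMzv hk hδ hδ1 hR).symm) q).1
  exact ⟨_, h1.tendsto_at hmem, h2.tendsto_at hmem⟩

/-! ### Taylor coefficients of both sides -/

/-- The `q`-th Taylor coefficient of `f` at `z`. -/
noncomputable def taylorCoeff (q : ℕ) (f : ℂ → ℂ) (z : ℂ) : ℂ :=
  iteratedDeriv q f z / (q.factorial : ℂ)

theorem taylorCoeff_zero (f : ℂ → ℂ) (z : ℂ) : taylorCoeff 0 f z = f z := by
  simp [taylorCoeff]

theorem taylorCoeff_const (q : ℕ) (c z : ℂ) :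
    taylorCoeff q (fun _ => c) z = if q = 0 then c else 0 := by
  rw [taylorCoeff, iteratedDeriv_const]
  split_ifs with h
  · simp [h]
  · simp

theorem taylorCoeff_sum {ι : Type*} (s : Finset ι) (q : ℕ) {f : ι → ℂ → ℂ} {z : ℂ}
    (hf : ∀ i ∈ s, AnalyticAt ℂ (f i) z) :
    taylorCoeff q (fun w => ∑ i ∈ s, f i w) z = ∑ i ∈ s, taylorCoeff q (f i) z := by
  simp only [taylorCoeff]
  rw [iteratedDeriv_fun_sum fun i hi => (hf i hi).contDiffAt, Finset.sum_div]

theorem taylorCoeff_add (q : ℕ) {f g : ℂ → ℂ} {z : ℂ} (hf : AnalyticAt ℂ f z)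
    (hg : AnalyticAt ℂ g z) :
    taylorCoeff q (fun w => f w + g w) z = taylorCoeff q f z + taylorCoeff q g z := by
  simp only [taylorCoeff]
  rw [iteratedDeriv_fun_add hf.contDiffAt hg.contDiffAt, add_div]

theorem taylorCoeff_mul (q : ℕ) {f g : ℂ → ℂ} {z : ℂ} (hf : AnalyticAt ℂ f z)
    (hg : AnalyticAt ℂ g z) :
    taylorCoeff q (fun w => f w * g w) z
      = ∑ p ∈ Finset.HasAntidiagonal.antidiagonal q, taylorCoeff p.1 f z * taylorCoeff p.2 g z := by
  rw [taylorCoeff, iteratedDeriv_fun_mul hf.contDiffAt hg.contDiffAt, Finset.sum_div,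
    Finset.Nat.sum_antidiagonal_eq_sum_range_succ fun i j => taylorCoeff i f z * taylorCoeff j g z]
  refine Finset.sum_congr rfl fun i hi => ?_
  have hi' : i ≤ q := by simp at hi; omega
  have h := Nat.choose_mul_factorial_mul_factorial hi'
  have h1 : (q.factorial : ℂ) = q.choose i * i.factorial * (q - i).factorial := by
    exact_mod_cast h.symm
  have h2 : (i.factorial : ℂ) ≠ 0 := by exact_mod_cast i.factorial_ne_zero
  have h3 : ((q - i).factorial : ℂ) ≠ 0 := by exact_mod_cast (q - i).factorial_ne_zero
  have h4 : (q.choose i : ℂ) ≠ 0 := by exact_mod_cast (Nat.choose_pos hi').ne'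
  rw [h1, taylorCoeff, taylorCoeff]
  field_simp

theorem taylorCoeff_mul_const (q : ℕ) {f : ℂ → ℂ} {z : ℂ} (hf : AnalyticAt ℂ f z) (c : ℂ) :
    taylorCoeff q (fun w => f w * c) z = taylorCoeff q f z * c := by
  rw [taylorCoeff_mul q hf analyticAt_const, Finset.sum_eq_single (q, 0)]
  · simp [taylorCoeff_const]
  · rintro ⟨i, j⟩ hij hne
    have hj : j ≠ 0 := by
      rintro rfl
      simp at hij hne
      exact hne hij
    simp [taylorCoeff_const, hj]
  · simp

/-- Only two Leibniz terms survive; this matches the recursion `hurwitzMhs_succ_ones`. -/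
theorem taylorCoeff_mul_linear (q : ℕ) {f : ℂ → ℂ} {z : ℂ} (hf : AnalyticAt ℂ f z) (a b : ℂ) :
    taylorCoeff (q + 1) (fun w => f w * ((w + a) / b)) z
      = taylorCoeff (q + 1) f z * ((z + a) / b) + taylorCoeff q f z / b := by
  have hd : deriv (fun w : ℂ => (w + a) / b) = fun _ => 1 / b := by
    ext w
    simp
  have hlin : ∀ j, taylorCoeff (j + 2) (fun w : ℂ => (w + a) / b) z = 0 := fun j => by
    rw [taylorCoeff, iteratedDeriv_succ', hd, iteratedDeriv_const]
    simp
  have h1 : taylorCoeff 1 (fun w : ℂ => (w + a) / b) z = 1 / b := by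
    rw [taylorCoeff, iteratedDeriv_one, hd]
    simp
  have hl : AnalyticAt ℂ (fun w : ℂ => (w + a) / b) z := by
    simp only [div_eq_mul_inv]
    exact (analyticAt_id.add analyticAt_const).mul analyticAt_const
  have hcomm : (fun w => f w * ((w + a) / b)) = fun w => ((w + a) / b) * f w := by
    ext w; ring
  rw [hcomm, taylorCoeff_mul _ hl hf, Finset.Nat.sum_antidiagonal_eq_sum_range_succ
    fun i j => taylorCoeff i (fun w : ℂ => (w + a) / b) z * taylorCoeff j f z,
    Finset.sum_range_succ', Finset.sum_range_succ', Finset.sum_eq_zero]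
  · rw [zero_add, h1, taylorCoeff_zero]
    simp
    ring
  · intro j _
    rw [hlin, zero_mul]

theorem analyticAt_risingQuot (n : ℕ) (z : ℂ) : AnalyticAt ℂ (fun z : ℂ => risingQuot z n) z :=
  (differentiable_risingQuot n).analyticAt z

theorem hurwitzMhs_succ_ones (α : ℂ) (n q : ℕ) :
    hurwitzMhs α (n + 1) (List.replicate (q + 1) 1)
      = hurwitzMhs α n (List.replicate (q + 1) 1)
        + 1 / (α + n) * hurwitzMhs α n (List.replicate q 1) := by
  rw [List.replicate_succ, hurwitzMhs, hurwitzMhs, Finset.sum_Icc_succ_top (by omega)]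
  congr 2
  push_cast
  rw [pow_one]
  congr 1
  ring

/-- Factoring `α+i+h = (α+i)(1 + h/(α+i))`, the coefficient of `h^q` is an elementary symmetric
polynomial in the `1/(α+i)`, which is `ζ_n({1}_q; α)`. The factors `α+i` are nonzero because `α` is
not an integer. -/
theorem taylorCoeff_risingQuot {α : ℂ} (hα : ∀ m : ℤ, α ≠ m) (n q : ℕ) :
    taylorCoeff q (fun z => risingQuot z n) α
      = risingQuot α n * hurwitzMhs α n (List.replicate q 1) := by
  induction n generalizing q with
  | zero =>
    cases q with
    | zero => simp [risingQuot, taylorCoeff_const, hurwitzMhs]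
    | succ q => simp [risingQuot, taylorCoeff_const, hurwitzMhs, List.replicate_succ]
  | succ n ih =>
    cases q with
    | zero => simp [taylorCoeff_zero, hurwitzMhs]
    | succ q =>
      have h0 : α + n ≠ 0 := fun h => hα (-n) (by push_cast; linear_combination h)
      have hn : (n : ℂ) + 1 ≠ 0 := by exact_mod_cast n.succ_ne_zero
      simp only [risingQuot_succ]
      rw [taylorCoeff_mul_linear q (analyticAt_risingQuot n α), ih, ih, hurwitzMhs_succ_ones]
      field_simp

theorem iteratedDeriv_inv_pow {z : ℂ} (hz : z.re < 1) {m : ℕ} (hm : 1 ≤ m) (a i : ℕ) :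
    iteratedDeriv i (fun z : ℂ => (1 / ((m : ℂ) + (1 - z) - 1)) ^ a) z
      = (a.ascFactorial i : ℂ) * (1 / ((m : ℂ) + (1 - z) - 1)) ^ (a + i) := by
  induction i generalizing z with
  | zero => simp
  | succ i ih =>
    have hev : iteratedDeriv i (fun z : ℂ => (1 / ((m : ℂ) + (1 - z) - 1)) ^ a)
        =ᶠ[𝓝 z] fun z => (a.ascFactorial i : ℂ) * (1 / ((m : ℂ) + (1 - z) - 1)) ^ (a + i) := by
      filter_upwards [(isOpen_lt Complex.continuous_re continuous_const).mem_nhds hz] with w hw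
      exact ih hw
    have h0 := hcoef_ne_zero hz hm
    have hlin : HasDerivAt (fun z : ℂ => (m : ℂ) + (1 - z) - 1) (-1) z := by
      simpa using (((hasDerivAt_id z).const_sub 1).const_add (m : ℂ)).sub_const 1
    have hd := ((hlin.fun_inv h0).fun_pow (a + i)).const_mul (a.ascFactorial i : ℂ)
    rw [iteratedDeriv_succ, hev.deriv_eq]
    simp only [one_div]
    rw [hd.deriv, Nat.ascFactorial_succ]
    -- The power rule produces the truncated exponent `a + i - 1`, so exponent `0` is separate.
    rcases Nat.eq_zero_or_pos (a + i) with h | h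
    · obtain ⟨rfl, rfl⟩ : a = 0 ∧ i = 0 := by omega
      simp
    · obtain ⟨j, hj⟩ : ∃ j, a + i = j + 1 := ⟨a + i - 1, by omega⟩
      rw [← add_assoc, hj]
      push_cast
      simp only [pow_succ]
      have hc : (a : ℂ) + i = j + 1 := by exact_mod_cast hj
      field_simp

theorem taylorCoeff_inv_pow {z : ℂ} (hz : z.re < 1) {m : ℕ} (hm : 1 ≤ m) (a i : ℕ) :
    taylorCoeff i (fun z : ℂ => (1 / ((m : ℂ) + (1 - z) - 1)) ^ a) z
      = ((a + i - 1).choose i : ℂ) * (1 / ((m : ℂ) + (1 - z) - 1)) ^ (a + i) := by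
  have h2 : (i.factorial : ℂ) ≠ 0 := by exact_mod_cast i.factorial_ne_zero
  rw [taylorCoeff, iteratedDeriv_inv_pow hz hm, Nat.ascFactorial_eq_factorial_mul_choose']
  push_cast
  field_simp

theorem sum_antidiagonalTuple_succ {M : Type*} [AddCommMonoid M] (n q : ℕ)
    (F : (Fin (n + 1) → ℕ) → M) :
    ∑ j ∈ Finset.Nat.antidiagonalTuple (n + 1) q, F j
      = ∑ p ∈ Finset.HasAntidiagonal.antidiagonal q, ∑ j ∈ Finset.Nat.antidiagonalTuple n p.2,
          F (Fin.cons p.1 j) := by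
  rw [Finset.sum_sigma']
  symm
  refine Finset.sum_bij' (fun x _ => Fin.cons x.1.1 x.2)
    (fun j _ => ⟨(j 0, ∑ i, Fin.tail j i), Fin.tail j⟩) ?_ ?_ ?_ ?_ ?_
  · rintro ⟨⟨a, b⟩, j⟩ h
    simp only [Finset.mem_sigma, Finset.HasAntidiagonal.mem_antidiagonal,
      Finset.Nat.mem_antidiagonalTuple] at h ⊢
    rw [Fin.sum_univ_succ]
    simp only [Fin.cons_zero, Fin.cons_succ]
    omega
  · intro j h
    simp only [Finset.mem_sigma, Finset.HasAntidiagonal.mem_antidiagonal,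
      Finset.Nat.mem_antidiagonalTuple] at h ⊢
    rw [Fin.sum_univ_succ] at h
    exact ⟨h, trivial⟩
  · rintro ⟨⟨a, b⟩, j⟩ h
    simp only [Finset.mem_sigma, Finset.HasAntidiagonal.mem_antidiagonal,
      Finset.Nat.mem_antidiagonalTuple] at h
    obtain ⟨h1, rfl⟩ := h
    simp
  · intro j _
    simp
  · intros
    rfl

theorem analyticAt_hurwitzMhs {z : ℂ} (hz : z.re < 1) (s : List ℕ) (n : ℕ) :
    AnalyticAt ℂ (fun z : ℂ => hurwitzMhs (1 - z) n s) z := by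
  simp only [hurwitzMhs_eq_sum]
  exact analyticAt_hurwitzSeries hz s (n + 1)

/-- Leibniz distributes the order `q` over the variables; the factor with exponent `a` receiving
order `i` contributes `binom(a+i-1, i)`. No signs appear, since the denominators are `m - z`. -/
theorem taylorCoeff_hurwitzMhs {z : ℂ} (hz : z.re < 1) (s : List ℕ) (n q : ℕ) :
    taylorCoeff q (fun z : ℂ => hurwitzMhs (1 - z) n s) z
      = ∑ j ∈ Finset.Nat.antidiagonalTuple s.length q,
          (binomProd s (List.ofFn j) : ℂ)
            * hurwitzMhs (1 - z) n (List.zipWith (· + ·) s (List.ofFn j)) := by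
  induction s generalizing n q with
  | nil =>
    cases q with
    | zero => simp [hurwitzMhs, taylorCoeff_const, binomProd]
    | succ q => simp [hurwitzMhs, taylorCoeff_const]
  | cons a t ih =>
    simp only [List.length_cons]
    rw [sum_antidiagonalTuple_succ]
    have hinv : ∀ m ∈ Finset.Icc 1 n,
        AnalyticAt ℂ (fun z : ℂ => (1 / ((m : ℂ) + (1 - z) - 1)) ^ a) z := fun m hm => by
      have h : AnalyticAt ℂ (fun z : ℂ => (m : ℂ) + (1 - z) - 1) z := by fun_prop
      exact (AnalyticAt.div analyticAt_const h (hcoef_ne_zero hz (Finset.mem_Icc.1 hm).1)).pow a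
    have hfun : (fun z : ℂ => hurwitzMhs (1 - z) n (a :: t)) = fun z : ℂ =>
        ∑ m ∈ Finset.Icc 1 n,
          (1 / ((m : ℂ) + (1 - z) - 1)) ^ a * hurwitzMhs (1 - z) (m - 1) t := by
      ext w
      simp only [hurwitzMhs, one_div, inv_pow]
    rw [hfun, taylorCoeff_sum (f := fun (m : ℕ) (z : ℂ) =>
        (1 / ((m : ℂ) + (1 - z) - 1)) ^ a * hurwitzMhs (1 - z) (m - 1) t) _ _
        fun m hm => (hinv m hm).mul (analyticAt_hurwitzMhs hz t (m - 1)),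
      Finset.sum_congr rfl fun m hm =>
      taylorCoeff_mul q (hinv m hm) (analyticAt_hurwitzMhs hz t (m - 1)), Finset.sum_comm]
    refine Finset.sum_congr rfl fun p _ => ?_
    rw [Finset.sum_congr rfl fun m hm => by
      rw [ih, taylorCoeff_inv_pow hz (Finset.mem_Icc.1 hm).1, Finset.mul_sum], Finset.sum_comm]
    refine Finset.sum_congr rfl fun j _ => ?_
    rw [List.ofFn_cons, List.zipWith_cons_cons, hurwitzMhs, Finset.mul_sum]
    refine Finset.sum_congr rfl fun m _ => ?_
    simp only [binomProd, List.zipWith_cons_cons, List.prod_cons, one_div, inv_pow]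
    push_cast
    ring

/-! ### Convergence of the Apéry-type series and assembly -/

theorem gammaBinom_eq_risingQuot {α : ℂ} (hα : ∀ m : ℤ, α ≠ m) (n : ℕ) :
    gammaBinom (n + α - 1) n = risingQuot α n := by
  have hΓ : Complex.Gamma α ≠ 0 :=
    Complex.Gamma_ne_zero fun m h => hα (-m) (by push_cast; exact h)
  have h : ∀ n : ℕ, Complex.Gamma (n + α)
      = Complex.Gamma α * ((n.factorial : ℂ) * risingQuot α n) := by
    intro n
    induction n with
    | zero => simp [risingQuot]
    | succ n ih =>
      have h0 : (n : ℂ) + α ≠ 0 := fun h => hα (-n) (by push_cast; linear_combination h)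
      have hn : (n : ℂ) + 1 ≠ 0 := by exact_mod_cast n.succ_ne_zero
      rw [show ((n + 1 : ℕ) : ℂ) + α = (n + α) + 1 by push_cast; ring, Complex.Gamma_add_one _ h0,
        ih, risingQuot_succ, Nat.factorial_succ]
      push_cast
      field_simp
      ring
  have hf : (n.factorial : ℂ) ≠ 0 := by exact_mod_cast n.factorial_ne_zero
  rw [gammaBinom, show (n : ℂ) + α - 1 + 1 = n + α by ring,
    show (n : ℂ) + α - 1 - n + 1 = α by ring, h, Complex.Gamma_nat_eq_factorial]
  field_simp

/-- The ratio `m / (m + α - 1)` converges, hence is bounded, without any restriction on `Re α` from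
below. -/
theorem exists_norm_hcoef_le (α : ℂ) :
    ∃ K : ℝ, 0 ≤ K ∧ ∀ m : ℕ, 1 ≤ m → ‖1 / ((m : ℂ) + α - 1)‖ ≤ K / m := by
  have h := (tendsto_natCast_div_add_atTop (α - 1)).norm.bddAbove_range
  obtain ⟨K, hK⟩ := h
  refine ⟨max K 0, le_max_right _ _, fun m hm => ?_⟩
  have hm0 : (0 : ℝ) < m := by exact_mod_cast hm
  rw [le_div_iff₀ hm0]
  refine le_trans (le_of_eq ?_) ((hK ⟨m, rfl⟩).trans (le_max_left _ _))
  simp only [norm_div, norm_one, Complex.norm_natCast, add_sub_assoc]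
  ring

theorem norm_mhsStar_le (s : List ℕ) (hs : ∀ a ∈ s, 0 < a) (n : ℕ) :
    ‖mhsStar n s‖ ≤ logBound n ^ s.length := by
  induction s generalizing n with
  | nil => simp [mhsStar]
  | cons a t ih =>
    refine (norm_sum_le _ _).trans (le_trans (Finset.sum_le_sum fun m hm => ?_)
      (sum_logBound_pow_div_le t.length n))
    have hm1 := (Finset.mem_Icc.1 hm).1
    have hm0 : (0 : ℝ) < m := by exact_mod_cast hm1
    have h1 := ih (fun b hb => hs b (by simp [hb])) m
    have h2 : (m : ℝ) ≤ (m : ℝ) ^ a := by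
      exact_mod_cast Nat.le_self_pow (hs a (by simp)).ne' m
    rw [norm_mul, norm_div, norm_one, norm_pow, Complex.norm_natCast, one_div_mul_eq_div]
    have := logBound_nonneg m
    gcongr

theorem summable_aperyTerm {α : ℂ} (hα : ∀ m : ℤ, α ≠ m) (hre : α.re < 1) (q : ℕ) {s : List ℕ}
    (hs : ∀ a ∈ s, 0 < a) {e : ℕ} (he : 1 ≤ e) :
    Summable fun n : ℕ => aperyTerm α q s e (n + 1) := by
  obtain ⟨δ, hδ, hδ'⟩ := exists_between (show 0 < 1 - α.re by linarith)
  obtain ⟨C, hC0, hC⟩ := exists_norm_risingQuot_le hδ (‖α‖ + 1)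
  obtain ⟨K, hK0, hK⟩ := exists_norm_hcoef_le α
  have hmem : α ∈ halfDisc δ (‖α‖ + 1) := ⟨by show α.re < 1 - δ; linarith, by simp⟩
  refine Summable.of_norm_bounded (g := fun n : ℕ => C * K ^ q
    * (((n + 1 : ℕ) : ℝ) ^ (-1 - δ) * logBound (n + 1) ^ (q + s.length)))
    (((summable_nat_add_iff 1).2 (summable_rpow_mul_logBound_pow (q + s.length)
      (by linarith : -1 - δ < -1))).mul_left _) fun n => ?_
  have hn : (0 : ℝ) < (n + 1 : ℕ) := by positivity
  have h1 := hC α hmem (n + 1) (by omega)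
  have h2 : ‖hurwitzMhs α (n + 1) (List.replicate q 1)‖ ≤ K ^ q * logBound (n + 1) ^ q := by
    rw [hurwitzMhs_eq_sum]
    simpa using norm_sum_mterm_le hK0 hK (List.replicate q 1)
      (fun a ha => by rw [List.eq_of_mem_replicate ha]; exact one_pos) (n + 1)
  have h3 := norm_mhsStar_le s hs (n + 1)
  have h4 : ((n + 1 : ℕ) : ℝ) ≤ ((n + 1 : ℕ) : ℝ) ^ e := by
    exact_mod_cast Nat.le_self_pow (by omega) (n + 1)
  have hl := logBound_nonneg (n + 1)
  rw [aperyTerm, gammaBinom_eq_risingQuot hα, norm_div, norm_mul, norm_mul, norm_pow,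
    Complex.norm_natCast]
  calc _ ≤ C * ((n + 1 : ℕ) : ℝ) ^ (-δ) * (K ^ q * logBound (n + 1) ^ q)
        * logBound (n + 1) ^ s.length / ((n + 1 : ℕ) : ℝ) := by gcongr
    _ = _ := by
      have h := Real.rpow_sub_one hn.ne' (-δ)
      rw [show -1 - δ = -δ - 1 by ring, h, pow_add]
      ring

theorem length_addHead (l : List ℕ) : (addHead l).length = l.length := by
  cases l <;> rfl

/-- Identifies the number of entries of `j` in the theorem with the depth of the dual index. -/
theorem length_hoffmanDual {k : List ℕ} (hk : IsComposition k) :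
    (hoffmanDual k).length + k.length = k.sum + 1 := by
  obtain ⟨hne, hpos⟩ := hk
  induction k with
  | nil => exact absurd rfl hne
  | cons m t ih =>
    have hm := hpos m (by simp)
    cases t with
    | nil => simp [hoffmanDual]
    | cons m' t =>
      have h := ih (by simp) fun b hb => hpos b (by simp [hb])
      simp only [hoffmanDual, List.length_append, List.length_replicate, length_addHead,
        List.length_cons, List.sum_cons] at h ⊢
      omega

theorem taylorCoeff_momentSeries {α : ℂ} (hα : ∀ m : ℤ, α ≠ m) (k : List ℕ) (q N : ℕ) :
    taylorCoeff q (momentSeries k N) α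
      = (if q = 0 then (moment k 0 : ℂ) else 0)
        + ∑ n ∈ Finset.range N, risingQuot α (n + 1)
            * hurwitzMhs α (n + 1) (List.replicate q 1) * (moment k (n + 1) : ℂ) := by
  have h : ∀ n, AnalyticAt ℂ (fun z : ℂ => risingQuot z (n + 1) * (moment k (n + 1) : ℂ)) α :=
    fun n => (analyticAt_risingQuot (n + 1) α).mul analyticAt_const
  change taylorCoeff q (fun z : ℂ => (moment k 0 : ℂ) + ∑ n ∈ Finset.range N,
    risingQuot z (n + 1) * (moment k (n + 1) : ℂ)) α = _
  rw [taylorCoeff_add q analyticAt_const (Finset.analyticAt_fun_sum _ fun n _ => h n),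
    taylorCoeff_const, taylorCoeff_sum _ _ fun n _ => h n]
  congr 1
  refine Finset.sum_congr rfl fun n _ => ?_
  rw [taylorCoeff_mul_const q (analyticAt_risingQuot (n + 1) α), taylorCoeff_risingQuot hα]

theorem isAdmissible_zipWith_add {s : List ℕ} (hs : IsAdmissible s) (j : List ℕ) :
    IsAdmissible (List.zipWith (· + ·) s j) := by
  constructor
  · intro m hm
    obtain ⟨i, hi, rfl⟩ := List.mem_iff_getElem.1 hm
    rw [List.getElem_zipWith]
    have hi' : i < s.length := by simp at hi; omega
    have := hs.1 _ (List.getElem_mem hi')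
    omega
  · cases s with
    | nil => simp
    | cons a t =>
      cases j with
      | nil => simp
      | cons b j =>
        have := hs.2 a (by simp)
        simp
        omega

theorem one_le_part_one {k : List ℕ} (hk : IsComposition k) : 1 ≤ part k 1 := by
  obtain ⟨a, t, rfl⟩ := List.exists_cons_of_ne_nil hk.1
  exact hk.2 a (by simp)

theorem pos_of_mem_seg_append {k : List ℕ} (hk : IsComposition k) {i l j : ℕ} (hj : 1 ≤ j) :
    ∀ a ∈ seg k i l ++ [j], 0 < a := by
  intro a ha
  rcases List.mem_append.1 ha with ha | ha
  · exact hk.2 a (List.mem_of_mem_take (List.mem_of_mem_drop ha))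
  · rw [List.mem_singleton.1 ha]
    exact hj

theorem hasSum_aperyTerm_moment {k : List ℕ} (hk : IsComposition k) {α : ℂ}
    (hα : ∀ m : ℤ, α ≠ m) (hre : α.re < 1) (q : ℕ) :
    HasSum (fun n : ℕ => risingQuot α (n + 1) * hurwitzMhs α (n + 1) (List.replicate q 1)
        * (moment k (n + 1) : ℂ))
      (∑ j ∈ Finset.Icc 1 (part k 1 - 1),
          (-1 : ℂ) ^ (j - 1) * mzv ((part k 1 + 1 - j) :: seg k 2 k.length) * aperySeries α q [] j
        + ∑ l ∈ Finset.Icc 1 k.length, (-1 : ℂ) ^ ((seg k 1 l).sum - l)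
            * ∑ j ∈ Finset.Icc 1 (part k (l + 1) - 1),
                (-1 : ℂ) ^ (j - 1) * mzv (tailIndex k l j)
                  * aperySeries α q (seg k 2 l ++ [j]) (part k 1)) := by
  have h1 : ∀ j ∈ Finset.Icc 1 (part k 1 - 1), HasSum (fun n : ℕ =>
      (-1 : ℂ) ^ (j - 1) * mzv ((part k 1 + 1 - j) :: seg k 2 k.length)
        * aperyTerm α q [] j (n + 1)) _ := fun j hj =>
    ((summable_aperyTerm hα hre q (s := []) (by simp) (Finset.mem_Icc.1 hj).1).hasSum).mul_left _
  have h2 : ∀ l, ∀ j ∈ Finset.Icc 1 (part k (l + 1) - 1), HasSum (fun n : ℕ =>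
      (-1 : ℂ) ^ (j - 1) * mzv (tailIndex k l j)
        * aperyTerm α q (seg k 2 l ++ [j]) (part k 1) (n + 1)) _ := fun l j hj =>
    ((summable_aperyTerm hα hre q (pos_of_mem_seg_append hk (Finset.mem_Icc.1 hj).1)
      (one_le_part_one hk)).hasSum).mul_left _
  refine HasSum.congr_fun ((hasSum_sum h1).add (hasSum_sum fun l _ =>
    (hasSum_sum (h2 l)).mul_left ((-1 : ℂ) ^ ((seg k 1 l).sum - l)))) fun n => ?_
  rw [moment_eq hk (by omega : 1 ≤ n + 1), mul_add]
  simp only [Finset.mul_sum, aperyTerm, gammaBinom_eq_risingQuot hα]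
  congr 1
  · refine Finset.sum_congr rfl fun j _ => ?_
    simp only [mhsStar]
    ring
  · refine Finset.sum_congr rfl fun l _ => Finset.sum_congr rfl fun j _ => ?_
    ring

theorem tendsto_taylorCoeff_hurwitzSeries {s : List ℕ} (hs : IsAdmissible s) {α : ℂ}
    (hre : α.re < 1) (q : ℕ) :
    Tendsto (fun N => taylorCoeff q (hurwitzSeries s (N + 1)) α) atTop
      (𝓝 (∑ j ∈ Finset.Nat.antidiagonalTuple s.length q, (binomProd s (List.ofFn j) : ℂ)
        * hurwitzMzv (1 - α) (List.zipWith (· + ·) s (List.ofFn j)))) := by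
  -- The shift to `N + 1` accounts for the slice `m = 0`: `ζ_N` runs over `range (N + 1)`.
  have h : ∀ N, taylorCoeff q (hurwitzSeries s (N + 1)) α
      = ∑ j ∈ Finset.Nat.antidiagonalTuple s.length q, (binomProd s (List.ofFn j) : ℂ)
        * hurwitzMhs (1 - α) N (List.zipWith (· + ·) s (List.ofFn j)) := fun N => by
    rw [← taylorCoeff_hurwitzMhs hre]
    simp only [hurwitzMhs_eq_sum]
    rfl
  simp only [h]
  exact tendsto_finsetSum _ fun j _ =>
    (hasSum_hurwitz_of_re_lt hre (isAdmissible_zipWith_add hs _)).2.const_mul _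

end Apery

theorem mainTheorem6 (k : List ℕ) (hk : Apery.IsComposition k) (q : ℕ) (α : ℂ)
    (hα : ∀ m : ℤ, α ≠ m) (hre : α.re < 1) :
    -- all multiple zeta values and Hurwitz-type multiple zeta values converge
    (∀ s : List ℕ, Apery.IsAdmissible s →
      Filter.Tendsto (fun n => Apery.mhs n s) Filter.atTop (nhds (Apery.mzv s)) ∧
      Filter.Tendsto (fun n => Apery.hurwitzMhs (1 - α) n s) Filter.atTop
        (nhds (Apery.hurwitzMzv (1 - α) s))) ∧
    -- all series on the left-hand side converge
    (∀ j ∈ Finset.Icc 1 (Apery.part k 1 - 1),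
      Summable fun n : ℕ => Apery.aperyTerm α q [] j (n + 1)) ∧
    (∀ l ∈ Finset.Icc 1 k.length, ∀ j ∈ Finset.Icc 1 (Apery.part k (l + 1) - 1),
      Summable fun n : ℕ =>
        Apery.aperyTerm α q (Apery.seg k 2 l ++ [j]) (Apery.part k 1) (n + 1)) ∧
    -- the identity
    (if q = 0 then 1 else 0) * Apery.mzv (Apery.addHead k)
      + ∑ j ∈ Finset.Icc 1 (Apery.part k 1 - 1),
          (-1 : ℂ) ^ (j - 1)
            * Apery.mzv ((Apery.part k 1 + 1 - j) :: Apery.seg k 2 k.length)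
            * Apery.aperySeries α q [] j
      + ∑ l ∈ Finset.Icc 1 k.length,
          (-1 : ℂ) ^ ((Apery.seg k 1 l).sum - l)
            * ∑ j ∈ Finset.Icc 1 (Apery.part k (l + 1) - 1),
                (-1 : ℂ) ^ (j - 1)
                  * Apery.mzv (Apery.tailIndex k l j)
                  * Apery.aperySeries α q (Apery.seg k 2 l ++ [j]) (Apery.part k 1)
      = ∑ j ∈ Finset.Nat.antidiagonalTuple (k.sum + 1 - k.length) q,
          (Apery.binomProd (Apery.addHead (Apery.hoffmanDual k.reverse)) (List.ofFn j) : ℂ)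
            * Apery.hurwitzMzv (1 - α)
                (List.zipWith (· + ·) (Apery.addHead (Apery.hoffmanDual k.reverse))
                  (List.ofFn j)) := by
  open Apery in
  refine ⟨fun s hs => ⟨tendsto_mhs hs, (hasSum_hurwitz_of_re_lt hre hs).2⟩,
    fun j hj => summable_aperyTerm hα hre q (by simp) (Finset.mem_Icc.1 hj).1,
    fun l _ j hj => summable_aperyTerm hα hre q (pos_of_mem_seg_append hk (Finset.mem_Icc.1 hj).1)
      (one_le_part_one hk), ?_⟩
  have hadm := isAdmissible_addHead_hoffmanDual hk.reverse
  have hlen : k.sum + 1 - k.length = (addHead (hoffmanDual k.reverse)).length := by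
    have h := length_hoffmanDual hk.reverse
    rw [List.length_reverse, List.sum_reverse] at h
    rw [length_addHead]
    omega
  rw [hlen]
  -- The common limit `l`, divided by `q!`, is evaluated once on the Hurwitz side and once on the
  -- moment side.
  obtain ⟨l, h1, h2⟩ := eq_iteratedDeriv_limits hk hre q
  have h3 := (h2.comp (tendsto_add_atTop_nat 1)).div_const (q.factorial : ℂ)
  have h4 := tendsto_nhds_unique h3 (tendsto_taylorCoeff_hurwitzSeries hadm.1 hre q)
  have h5 : Tendsto (fun N => taylorCoeff q (momentSeries k N) α) atTop
      (𝓝 (l / (q.factorial : ℂ))) := h1.div_const _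
  simp only [taylorCoeff_momentSeries hα] at h5
  have h6 := tendsto_nhds_unique h5
    ((hasSum_aperyTerm_moment hk hα hre q).tendsto_sum_nat.const_add _)
  have h7 : (moment k 0 : ℂ) = mzv (addHead k) := by
    obtain ⟨a, t, rfl⟩ := List.exists_cons_of_ne_nil hk.1
    rw [moment, momentE_zero hk.1, toReal_mzvE]
    have ha := hk.2 a (by simp)
    exact ⟨fun b hb => by
      rcases List.mem_cons.1 hb with rfl | hb
      · omega
      · exact hk.2 b (by simp [hb]), by simp [addHead]; omega⟩
  rw [← h4, h6, h7, add_assoc, ite_mul, one_mul, zero_mul]
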